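/- Let $M$ and $N$ be matroids on finite ground sets $E$ and $F$, with rank functions $\operatorname{rk}_M$ and $\operatorname{rk}_N$, and let $f\colon M\to N$ be a morphism of matroids, that is, a function $f\colon E\to F$ such that \[ \operatorname{rk}_N(f(S_2))-\operatorname{rk}_N(f(S_1))\le \operatorname{rk}_M(S_2)-\operatorname{rk}_M(S_1)\qquad\text{for all } S_1\subseteq S_2\subseteq E . \] Let $\mathscr B(f)$ be the set of bases of $f$, that is, of all subsets $S\subseteq E$ such that $S$ is contained in a basis of $M$ and $f(S)$ contains a basis of $N$. Then the basis generating polynomial \[ \underline{\mathrm B}_f(w)=\sum_{S\in\mathscr B(f)}\ \prod_{i\in S}w_i\ \in\ \mathbb R[w_i : i\in E] \] is either identically zero or log-concave on the positive orthant $\mathbb R^E_{>0}$ (that is, it is positive there and its logarithm is a concave function there). In fact, $\underline{\mathrm B}_f$ is strongly log-concave: its coefficients are nonnegative, and for every $k\ge 0$ and all $i_1,\dots,i_k\in E$ the partial derivative $\partial_{i_1}\cdots\partial_{i_k}\underline{\mathrm B}_f$ is either identically zero or log-concave on $\mathbb R^E_{>0}$. -/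

import Mathlib

namespace MatroidMorphism

/-- The rank `rk_M(S)` as a natural number: the largest size of an independent subset of `S`.
It is only used for finite `S`, where `Matroid.eRk` is finite. -/
noncomputable def rk {E : Type*} (M : Matroid E) (S : Set E) : ℕ :=
  (M.eRk S).toNat

/-- A function `f : E → F` is a morphism from a matroid `M` on `E` to a matroid `N` on `F` if
`rk_N(f(S₂)) - rk_N(f(S₁)) ≤ rk_M(S₂) - rk_M(S₁)` for all `S₁ ⊆ S₂ ⊆ E`. -/
def IsMorphism {E F : Type*} (M : Matroid E) (N : Matroid F) (f : E → F) : Prop :=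
  ∀ S₁ S₂ : Set E, S₁ ⊆ S₂ →
    (rk N (f '' S₂) : ℤ) - (rk N (f '' S₁) : ℤ) ≤ (rk M S₂ : ℤ) - (rk M S₁ : ℤ)

/-- `S` is a basis of `f : M → N` if `S` is contained in a basis of `M` and `f(S)` contains a
basis of `N`. -/
def IsBasisOf {E F : Type*} (M : Matroid E) (N : Matroid F) (f : E → F) (S : Set E) : Prop :=
  (∃ B, M.IsBase B ∧ S ⊆ B) ∧ (∃ C, N.IsBase C ∧ C ⊆ f '' S)

open Classical in
/-- The basis generating polynomial: the sum over all bases `S` of `f` of `∏ i ∈ S, w_i`. -/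
noncomputable def basisGenPoly {E F : Type*} [Fintype E] (M : Matroid E) (N : Matroid F)
    (f : E → F) : MvPolynomial E ℝ :=
  ∑ S : Finset E with IsBasisOf M N f (S : Set E), ∏ i ∈ S, MvPolynomial.X i

/-- The polynomial function of `h` is log-concave on the positive orthant: it is positive there
(so that its logarithm is defined) and its logarithm is a concave function there. -/
def IsLogConcave {σ : Type*} (h : MvPolynomial σ ℝ) : Prop :=
  (∀ w ∈ {w : σ → ℝ | ∀ i, 0 < w i}, 0 < MvPolynomial.eval w h) ∧
    ConcaveOn ℝ {w : σ → ℝ | ∀ i, 0 < w i} (fun w => Real.log (MvPolynomial.eval w h))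

/-- A polynomial `h` with nonnegative coefficients is strongly log-concave if each of its iterated
partial derivatives `∂_{i₁} ⋯ ∂_{iₖ} h`, for `k ≥ 0` (so `h` itself is included), is identically
zero or log-concave on the positive orthant. -/
def IsStronglyLogConcave {σ : Type*} (h : MvPolynomial σ ℝ) : Prop :=
  (∀ m : σ →₀ ℕ, 0 ≤ h.coeff m) ∧
    ∀ l : List σ,
      l.foldr (fun i g => MvPolynomial.pderiv i g) h = 0 ∨
        IsLogConcave (l.foldr (fun i g => MvPolynomial.pderiv i g) h)

end MatroidMorphism

open MvPolynomial

/-! Let `r` be the rank function of `M` on subsets of `E`, `q` the rank function of `N` applied to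
images under `f`, and `R` the rank of `N`. The bases of `f` are the `r`-independent sets of `q`-rank
`R`, and the morphism condition says that `q` is a quotient of `r`. The generating polynomial is
homogenized by a variable `w₀` (index `none`), with weights: `basisPoly r q R n d` is the sum, over
bases `S` with `|S| ≤ d`, of `(n - |S|)! / (d - |S|)! * w₀ ^ (d - |S|) * ∏ i ∈ S, w_i`. For `n = d`
all weights are `1`, and `w₀ = 1` gives back the original polynomial.

The weights make the family stable under derivatives: `∂₀` lowers `d`, while `∂_i` contracts `i` and
lowers `n` and `d` if `i` is a nonloop, and gives zero if `i` is a loop. The conditions `d ≤ n` and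
"at most `n` nonloops" persist. It therefore suffices to show that every nonzero member of the
family is log-concave on the positive orthant, an assertion that passes to the slice `w₀ = 1`.

For a homogeneous polynomial, log-concavity follows from a reversed Cauchy-Schwarz inequality for
the Hessian form at each positive point `a`, taken against `a` itself. This is proved by induction
on the degree. The local-to-global step `reversedCauchy_of_pderiv` passes from all first derivatives
to the polynomial, provided that the Hessian has connected support; `connected_hessian_basisPoly`
supplies this by basis extension. The quadratic case `reversedCauchy_basisPoly_two` reduces to
Cauchy-Schwarz over parallel classes, where the bound `n` on the number of nonloops is exactly what
is needed. -/

namespace MatroidMorphism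

/-! ### Quadratic forms: a local-to-global criterion and reversed Cauchy-Schwarz. -/

section QuadraticForms

variable {σ : Type*} [Fintype σ]

/-- The Dirichlet form of a symmetric matrix, in coordinates relative to a vector `a`. -/
theorem dirichlet_identity (Q : σ → σ → ℝ) (hs : ∀ i j, Q i j = Q j i) (a w : σ → ℝ) :
    ∑ i, ∑ j, Q i j * a i * a j * (w i - w j) ^ 2 =
      2 * (∑ i, (∑ j, Q i j * a j) * a i * w i ^ 2 -
        ∑ i, ∑ j, Q i j * (a i * w i) * (a j * w j)) := by
  have h1 : ∑ i, ∑ j, Q i j * a i * a j * (w i - w j) ^ 2 =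
      ∑ i, ∑ j, Q i j * a j * a i * w i ^ 2 + ∑ i, ∑ j, Q i j * a j * a i * w j ^ 2
        - 2 * ∑ i, ∑ j, Q i j * (a i * w i) * (a j * w j) := by
    simp only [Finset.mul_sum, ← Finset.sum_add_distrib, ← Finset.sum_sub_distrib]
    refine Finset.sum_congr rfl fun i _ => Finset.sum_congr rfl fun j _ => by ring
  have h2 : ∑ i, ∑ j, Q i j * a j * a i * w j ^ 2 = ∑ i, ∑ j, Q i j * a j * a i * w i ^ 2 := by
    rw [Finset.sum_comm]
    refine Finset.sum_congr rfl fun i _ => Finset.sum_congr rfl fun j _ => by rw [hs j i]; ring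
  rw [h1, h2]
  simp only [Finset.sum_mul]
  ring

/-- A symmetric matrix `Q` with nonnegative entries and connected support, such that
`xᵀ Q x ≤ ∑ i, a i (Q x)_i ^ 2 / (Q a)_i` for all `x`, is negative semidefinite on the
`Q`-orthogonal complement of the positive vector `a`. -/
theorem quadratic_nonpos_of_local (Q : σ → σ → ℝ) (hs : ∀ i j, Q i j = Q j i)
    (hn : ∀ i j, 0 ≤ Q i j) (a : σ → ℝ) (ha : ∀ i, 0 < a i)
    (hconn : ∀ u : σ → ℝ, (∀ i j, 0 < Q i j → u i = u j) →
      ∀ i j k l, 0 < Q i k → 0 < Q j l → u i = u j)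
    (hloc : ∀ x : σ → ℝ, ∑ i, ∑ j, Q i j * x i * x j ≤
      ∑ i, a i * (∑ j, Q i j * x j) ^ 2 / (∑ j, Q i j * a j))
    (x : σ → ℝ) (hx : ∑ i, ∑ j, Q i j * x i * a j = 0) :
    ∑ i, ∑ j, Q i j * x i * x j ≤ 0 := by
  classical
  set b : σ → ℝ := fun i => ∑ j, Q i j * a j with hb
  have hb0 : ∀ i, 0 ≤ b i := fun i => Finset.sum_nonneg fun j _ => mul_nonneg (hn i j) (ha j).le
  have hrow : ∀ i, b i = 0 → ∀ j, Q i j = 0 := by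
    intro i hi j
    have := (Finset.sum_eq_zero_iff_of_nonneg
      (fun j _ => mul_nonneg (hn i j) (ha j).le)).1 hi j (Finset.mem_univ j)
    exact (mul_eq_zero.1 this).resolve_right (ha j).ne'
  have hact : ∀ i, b i ≠ 0 → ∃ k, 0 < Q i k := by
    intro i hi
    by_contra! h
    exact hi (Finset.sum_eq_zero fun j _ => by rw [le_antisymm (h j) (hn i j), zero_mul])
  -- With `A = D⁻¹ Q`, self-adjoint for the inner product weighted by `D`, the hypothesis `hloc`
  -- says `A ≤ A²`, so every eigenvalue is `≤ 0` or `≥ 1`. Since `A ≤ 1`, with eigenvalue `1`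
  -- attained only along `a` on the nonzero rows, `A ≤ 0` on the complement of `a`. The argument
  -- below carries this out without diagonalizing, using `L = D - Q`. On zero rows of `Q` the value
  -- of `D` only has to be positive.
  set D : σ → ℝ := fun i => if b i = 0 then 1 else b i / a i with hD
  have hDpos : ∀ i, 0 < D i := by
    intro i
    simp only [hD]
    split_ifs with h
    · exact one_pos
    · exact div_pos (lt_of_le_of_ne (hb0 i) (Ne.symm h)) (ha i)
  let L : (σ → ℝ) →ₗ[ℝ] (σ → ℝ) :=
    { toFun := fun v i => D i * v i - ∑ j, Q i j * v j
      map_add' := fun v w => by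
        ext i
        simp only [Pi.add_apply, mul_add, Finset.sum_add_distrib]; ring
      map_smul' := fun c v => by
        ext i
        simp only [Pi.smul_apply, smul_eq_mul, RingHom.id_apply, mul_sub, Finset.mul_sum]
        congr 1
        · ring
        · exact Finset.sum_congr rfl fun j _ => by ring }
  have hL : ∀ v i, L v i = D i * v i - ∑ j, Q i j * v j := fun _ _ => rfl
  -- Adding the rank-one term `b bᵀ` removes the kernel of `L`, so that `L z = D x` can be solved.
  let T : (σ → ℝ) →ₗ[ℝ] (σ → ℝ) :=
    { toFun := fun v i => L v i + (∑ k, b k * v k) * b i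
      map_add' := fun v w => by
        ext i
        simp only [map_add, Pi.add_apply, mul_add, Finset.sum_add_distrib]; ring
      map_smul' := fun c v => by
        ext i
        have : ∑ k, b k * (c * v k) = c * ∑ k, b k * v k := by
          rw [Finset.mul_sum]; exact Finset.sum_congr rfl fun j _ => by ring
        simp only [map_smul, Pi.smul_apply, smul_eq_mul, RingHom.id_apply, this]
        ring }
  have hT : ∀ v i, T v i = L v i + (∑ k, b k * v k) * b i := fun _ _ => rfl
  have hLform : ∀ v : σ → ℝ, ∑ i, v i * L v i =
      ∑ i, D i * v i ^ 2 - ∑ i, ∑ j, Q i j * v i * v j := by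
    intro v
    rw [← Finset.sum_sub_distrib]
    refine Finset.sum_congr rfl fun i _ => ?_
    rw [hL, mul_sub, Finset.mul_sum]
    congr 1
    · ring
    · exact Finset.sum_congr rfl fun j _ => by ring
  have hLdir : ∀ v : σ → ℝ, ∑ i, v i * L v i =
      (∑ i, ∑ j, Q i j * a i * a j * (v i / a i - v j / a j) ^ 2) / 2 +
        ∑ i, if b i = 0 then v i ^ 2 else 0 := by
    intro v
    have e : ∀ i, a i * (v i / a i) = v i := fun i => mul_div_cancel₀ _ (ha i).ne'
    rw [dirichlet_identity Q hs, hLform]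
    simp only [e]
    have : ∑ i, D i * v i ^ 2 = ∑ i, b i * a i * (v i / a i) ^ 2 +
        ∑ i, if b i = 0 then v i ^ 2 else 0 := by
      rw [← Finset.sum_add_distrib]
      refine Finset.sum_congr rfl fun i _ => ?_
      have := (ha i).ne'
      simp only [hD]
      split_ifs with h
      · rw [h]; ring
      · field_simp; ring
    rw [this]
    ring
  have hterm1 : ∀ (v : σ → ℝ) i j, 0 ≤ Q i j * a i * a j * (v i / a i - v j / a j) ^ 2 :=
    fun v i j => mul_nonneg (mul_nonneg (mul_nonneg (hn i j) (ha i).le) (ha j).le) (sq_nonneg _)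
  have hterm2 : ∀ (v : σ → ℝ) i, 0 ≤ if b i = 0 then v i ^ 2 else 0 := by
    intro v i; split_ifs <;> positivity
  have hd1 : ∀ v : σ → ℝ, 0 ≤ ∑ i, ∑ j, Q i j * a i * a j * (v i / a i - v j / a j) ^ 2 :=
    fun v => Finset.sum_nonneg fun i _ => Finset.sum_nonneg fun j _ => hterm1 v i j
  have hd2 : ∀ v : σ → ℝ, 0 ≤ ∑ i, if b i = 0 then v i ^ 2 else 0 :=
    fun v => Finset.sum_nonneg fun i _ => hterm2 v i
  have hLnonneg : ∀ v : σ → ℝ, 0 ≤ ∑ i, v i * L v i := by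
    intro v
    rw [hLdir]
    have := hd1 v
    have := hd2 v
    positivity
  have hTinj : Function.Injective T := by
    rw [injective_iff_map_eq_zero]
    intro v hv
    have h0 : ∑ i, v i * T v i = 0 := by simp [hv]
    have h1 : ∑ i, v i * T v i = ∑ i, v i * L v i + (∑ k, b k * v k) ^ 2 := by
      simp only [hT, mul_add, Finset.sum_add_distrib]
      congr 1
      rw [sq, Finset.mul_sum]
      exact Finset.sum_congr rfl fun i _ => by ring
    have hLv : ∑ i, v i * L v i = 0 := by nlinarith [hLnonneg v, sq_nonneg (∑ k, b k * v k)]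
    have hbv : ∑ k, b k * v k = 0 := by
      have : (∑ k, b k * v k) ^ 2 = 0 := by linarith
      exact pow_eq_zero_iff (two_ne_zero) |>.1 this
    rw [hLdir] at hLv
    have e1 : ∑ i, ∑ j, Q i j * a i * a j * (v i / a i - v j / a j) ^ 2 = 0 := by
      linarith [hd1 v, hd2 v]
    have e2 : ∑ i, (if b i = 0 then v i ^ 2 else 0) = 0 := by linarith [hd1 v, hd2 v]
    have f1 : ∀ i j, 0 < Q i j → v i / a i = v j / a j := by
      intro i j hij
      have := (Finset.sum_eq_zero_iff_of_nonneg (fun i _ => Finset.sum_nonneg fun j _ =>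
        hterm1 v i j)).1 e1 i (Finset.mem_univ i)
      have := (Finset.sum_eq_zero_iff_of_nonneg (fun j _ => hterm1 v i j)).1 this j
        (Finset.mem_univ j)
      have h3 := (mul_eq_zero.1 this).resolve_left
        (mul_pos (mul_pos hij (ha i)) (ha j)).ne'
      exact sub_eq_zero.1 (pow_eq_zero_iff two_ne_zero |>.1 h3)
    have f2 : ∀ i, b i = 0 → v i = 0 := by
      intro i hi
      have := (Finset.sum_eq_zero_iff_of_nonneg (fun i _ => hterm2 v i)).1 e2 i
        (Finset.mem_univ i)
      rw [if_pos hi] at this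
      exact pow_eq_zero_iff two_ne_zero |>.1 this
    -- By connectivity `v` is a multiple of `a` on the nonzero rows, and pairing with `b` then
    -- forces the multiple to be zero.
    have f3 := hconn _ f1
    ext i
    by_cases hi : b i = 0
    · exact f2 i hi
    obtain ⟨k, hk⟩ := hact i hi
    have f4 : ∀ j, b j * v j = b j * (a j * (v i / a i)) := by
      intro j
      by_cases hj : b j = 0
      · rw [hj]; ring
      obtain ⟨l, hl⟩ := hact j hj
      rw [f3 i j k l hk hl, mul_div_cancel₀ _ (ha j).ne']
    simp only [f4, ← mul_assoc, ← Finset.sum_mul] at hbv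
    have hpos : 0 < ∑ j, b j * a j :=
      Finset.sum_pos' (fun j _ => mul_nonneg (hb0 j) (ha j).le)
        ⟨i, Finset.mem_univ i, mul_pos (lt_of_le_of_ne (hb0 i) (Ne.symm hi)) (ha i)⟩
    have := (mul_eq_zero.1 hbv).resolve_left hpos.ne'
    exact (div_eq_zero_iff.1 this).resolve_right (ha i).ne'
  obtain ⟨z, hz⟩ := LinearMap.injective_iff_surjective.1 hTinj (fun i => D i * x i)
  have hz' : ∀ i, L z i + (∑ k, b k * z k) * b i = D i * x i := fun i => by
    rw [← hT, hz]
  have hxb : ∑ i, b i * x i = 0 := by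
    rw [← hx]
    refine Finset.sum_congr rfl fun i _ => ?_
    rw [hb, Finset.sum_mul]
    exact Finset.sum_congr rfl fun j _ => by ring
  have hDa : ∀ i, a i * D i = b i + if b i = 0 then a i else 0 := by
    intro i
    have := (ha i).ne'
    simp only [hD]
    split_ifs with h
    · rw [h]; ring
    · field_simp; ring
  have hinact : ∀ i, b i = 0 → z i = x i := by
    intro i hi
    have := hz' i
    rw [hi, hL, mul_zero, add_zero, Finset.sum_eq_zero, sub_zero] at this
    · exact mul_left_cancel₀ (hDpos i).ne' this
    · intro j _; rw [hrow i hi j, zero_mul]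
  have haL : ∑ i, a i * L z i = ∑ i, if b i = 0 then a i * x i else 0 := by
    have h1 : ∑ i, a i * ∑ j, Q i j * z j = ∑ i, b i * z i := by
      simp only [Finset.mul_sum, hb, Finset.sum_mul]
      rw [Finset.sum_comm]
      exact Finset.sum_congr rfl fun i _ => Finset.sum_congr rfl fun j _ => by rw [hs j i]; ring
    simp only [hL, mul_sub, Finset.sum_sub_distrib, h1]
    rw [← Finset.sum_sub_distrib]
    refine Finset.sum_congr rfl fun i _ => ?_
    rw [← mul_assoc, hDa]
    split_ifs with h
    · rw [hinact i h]; ring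
    · ring
  -- Pairing `T z = D x` with `a` shows that the rank-one correction vanishes; in the second
  -- alternative `b` itself is zero.
  have hbz : ∑ k, b k * z k = 0 ∨ ∑ i, a i * b i = 0 := by
    have h1 : ∑ i, a i * (L z i + (∑ k, b k * z k) * b i) = ∑ i, a i * (D i * x i) :=
      Finset.sum_congr rfl fun i _ => by rw [hz']
    have h2 : ∑ i, a i * (D i * x i) = ∑ i, b i * x i + ∑ i, if b i = 0 then a i * x i else 0 := by
      rw [← Finset.sum_add_distrib]
      refine Finset.sum_congr rfl fun i _ => ?_
      rw [← mul_assoc, hDa]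
      split_ifs <;> ring
    have h3 : ∑ i, a i * (L z i + (∑ k, b k * z k) * b i) =
        ∑ i, a i * L z i + (∑ k, b k * z k) * ∑ i, a i * b i := by
      rw [Finset.mul_sum, ← Finset.sum_add_distrib]
      exact Finset.sum_congr rfl fun i _ => by ring
    rw [h3, h2, haL, hxb] at h1
    exact mul_eq_zero.1 (by linarith)
  have hLz : ∀ i, L z i = D i * x i := by
    intro i
    rcases hbz with h | h
    · have := hz' i
      rw [h] at this
      linarith
    · have hbi := (Finset.sum_eq_zero_iff_of_nonneg
        (fun i _ => mul_nonneg (ha i).le (hb0 i))).1 h i (Finset.mem_univ i)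
      have := hz' i
      rw [(mul_eq_zero.1 hbi).resolve_left (ha i).ne'] at this
      linarith
  set zx := ∑ i, D i * z i * x i with hzx
  set xx := ∑ i, D i * x i ^ 2 with hxx
  set zz := ∑ i, D i * z i ^ 2 with hzz
  have hzLz : ∑ i, z i * L z i = zx := Finset.sum_congr rfl fun i _ => by rw [hLz]; ring
  have hQz : ∀ i, ∑ j, Q i j * z j = D i * (z i - x i) := by
    intro i
    have := hL z i
    rw [hLz] at this
    linarith
  -- Here `A z = z - x`, so `⟨z, A z⟩ ≤ ⟨A z, A z⟩` becomes `⟨z, x⟩ ≤ ⟨x, x⟩`: the inverse of `1 -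
  -- A` is at most `1`.
  have hle1 : zx ≤ xx := by
    have h1 := hloc z
    have h2 : ∑ i, ∑ j, Q i j * z i * z j = zz - zx := by
      rw [hzz, hzx, ← Finset.sum_sub_distrib]
      refine Finset.sum_congr rfl fun i _ => ?_
      have : ∑ j, Q i j * z i * z j = z i * ∑ j, Q i j * z j := by
        rw [Finset.mul_sum]; exact Finset.sum_congr rfl fun j _ => by ring
      rw [this, hQz]; ring
    have h3 : ∑ i, a i * (∑ j, Q i j * z j) ^ 2 / b i = ∑ i, D i * (z i - x i) ^ 2 := by
      refine Finset.sum_congr rfl fun i _ => ?_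
      have := (ha i).ne'
      rw [hQz]
      by_cases h : b i = 0
      · rw [hinact i h]; simp
      · simp only [hD, if_neg h]; field_simp
    have h4 : ∑ i, D i * (z i - x i) ^ 2 = zz - 2 * zx + xx := by
      rw [hzz, hzx, hxx, Finset.mul_sum, ← Finset.sum_sub_distrib, ← Finset.sum_add_distrib]
      exact Finset.sum_congr rfl fun i _ => by ring
    change _ ≤ ∑ i, a i * (∑ j, Q i j * z j) ^ 2 / b i at h1
    rw [h2, h3, h4] at h1
    linarith
  -- Nonnegativity of `L` at `z - x` gives `xᵀ L x ≥ 2 xx - zx ≥ xx`, and `xᵀ L x = xx - xᵀ Q x`.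
  have h5 := hLnonneg (z - x)
  have h6 : ∑ i, (z - x) i * L (z - x) i =
      zx - 2 * xx + ∑ i, x i * L x i := by
    have hsym : ∑ i, z i * L x i = ∑ i, x i * L z i := by
      have h1 : ∑ i, z i * ∑ j, Q i j * x j = ∑ i, x i * ∑ j, Q i j * z j := by
        simp only [Finset.mul_sum]
        rw [Finset.sum_comm]
        exact Finset.sum_congr rfl fun i _ => Finset.sum_congr rfl fun j _ => by
          rw [hs j i]; ring
      simp only [hL, mul_sub, Finset.sum_sub_distrib, h1]
      congr 1
      exact Finset.sum_congr rfl fun i _ => by ring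
    have hxLz : ∑ i, x i * L z i = xx := Finset.sum_congr rfl fun i _ => by rw [hLz]; ring
    simp only [map_sub, Pi.sub_apply, sub_mul, mul_sub, Finset.sum_sub_distrib, hsym, hxLz, hzLz]
    ring
  rw [h6, hLform] at h5
  linarith

theorem quadratic_sub_mul (Q : σ → σ → ℝ) (y a : σ → ℝ) (s t : ℝ) :
    ∑ i, ∑ j, Q i j * (s * y i - t * a i) * (s * y j - t * a j) =
      s ^ 2 * (∑ i, ∑ j, Q i j * y i * y j) - s * t * (∑ i, ∑ j, Q i j * y i * a j)
        - s * t * (∑ i, ∑ j, Q i j * a i * y j) + t ^ 2 * (∑ i, ∑ j, Q i j * a i * a j) := by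
  simp only [Finset.mul_sum, ← Finset.sum_sub_distrib, ← Finset.sum_add_distrib]
  refine Finset.sum_congr rfl fun i _ => Finset.sum_congr rfl fun j _ => by ring

/-- If a quadratic form is nonpositive on the `Q`-orthogonal complement of `a`, then it satisfies
the reversed Cauchy-Schwarz inequality against `a`. -/
theorem reversed_cauchy_of_nonpos (Q : σ → σ → ℝ) (hs : ∀ i j, Q i j = Q j i) (a : σ → ℝ)
    (haa : 0 ≤ ∑ i, ∑ j, Q i j * a i * a j)
    (h : ∀ x : σ → ℝ, ∑ i, ∑ j, Q i j * x i * a j = 0 → ∑ i, ∑ j, Q i j * x i * x j ≤ 0)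
    (x : σ → ℝ) :
    (∑ i, ∑ j, Q i j * x i * x j) * (∑ i, ∑ j, Q i j * a i * a j) ≤
      (∑ i, ∑ j, Q i j * x i * a j) ^ 2 := by
  set q := ∑ i, ∑ j, Q i j * a i * a j with hq
  set l := ∑ i, ∑ j, Q i j * x i * a j with hl
  set s := ∑ i, ∑ j, Q i j * x i * x j with hsx
  have hl' : ∑ i, ∑ j, Q i j * a i * x j = l := by
    rw [hl, Finset.sum_comm]
    exact Finset.sum_congr rfl fun i _ => Finset.sum_congr rfl fun j _ => by rw [hs j i]; ring
  have h1 : ∑ i, ∑ j, Q i j * (q * x i - l * a i) * a j = q * l - l * q := by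
    conv_rhs => rw [hl]
    conv_rhs => enter [2, 2]; rw [hq]
    simp only [Finset.mul_sum, ← Finset.sum_sub_distrib]
    rw [← hl]
    refine Finset.sum_congr rfl fun i _ => Finset.sum_congr rfl fun j _ => by ring
  have h2 := quadratic_sub_mul Q x a q l
  rw [← hsx, ← hl, hl', ← hq] at h2
  -- This is `q` times the projection of `x` to the complement of `a`, written without division.
  have h3 := h (fun i => q * x i - l * a i) (by rw [h1]; ring)
  rw [h2] at h3
  rcases haa.eq_or_lt with h0 | h0
  · rw [← h0, mul_zero]; positivity
  · have : q * (s * q - l ^ 2) ≤ 0 := by nlinarith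
    nlinarith [nonpos_of_mul_nonpos_right this h0]

/-- If a quadratic form is nonpositive on a hyperplane, then it satisfies the reversed
Cauchy-Schwarz inequality. -/
theorem reversed_cauchy_of_hyperplane (Q : σ → σ → ℝ) (hs : ∀ i j, Q i j = Q j i) (a c : σ → ℝ)
    (haa : 0 ≤ ∑ i, ∑ j, Q i j * a i * a j)
    (h : ∀ x : σ → ℝ, ∑ i, c i * x i = 0 → ∑ i, ∑ j, Q i j * x i * x j ≤ 0)
    (x : σ → ℝ) :
    (∑ i, ∑ j, Q i j * x i * x j) * (∑ i, ∑ j, Q i j * a i * a j) ≤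
      (∑ i, ∑ j, Q i j * x i * a j) ^ 2 := by
  rcases haa.eq_or_lt with h0 | h0
  · rw [← h0, mul_zero]; positivity
  refine reversed_cauchy_of_nonpos Q hs a haa (fun y hy => ?_) x
  have hy' : ∑ i, ∑ j, Q i j * a i * y j = 0 := by
    rw [← hy, Finset.sum_comm]
    exact Finset.sum_congr rfl fun i _ => Finset.sum_congr rfl fun j _ => by rw [hs j i]; ring
  set s := ∑ i, c i * a i with hsdef
  set t := ∑ i, c i * y i with ht
  -- The plane spanned by `y` and `a` meets the hyperplane in this vector; as the cross terms
  -- vanish, its form value is `s² Q(y) + t² Q(a)`.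
  have h1 := h (fun i => s * y i - t * a i) (by
    have : ∑ i, c i * (s * y i - t * a i) = s * t - t * s := by
      conv_rhs => rw [ht]
      conv_rhs => enter [2]; rw [hsdef]
      simp only [Finset.mul_sum, ← Finset.sum_sub_distrib]
      rw [← ht]
      exact Finset.sum_congr rfl fun i _ => by ring
    rw [this]; ring)
  have h2 := quadratic_sub_mul Q y a s t
  rw [h2, hy, hy'] at h1
  by_cases hs0 : s = 0
  · exact absurd (h a hs0) (not_le.2 h0)
  · have : 0 < s ^ 2 := by positivity
    nlinarith [mul_nonneg (sq_nonneg t) h0.le]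

end QuadraticForms

/-! ### Hessians of homogeneous polynomials and log-concavity. -/

section Hessian

variable {σ : Type*}

theorem pderiv_pderiv_comm (i j : σ) (p : MvPolynomial σ ℝ) :
    pderiv i (pderiv j p) = pderiv j (pderiv i p) := by
  classical
  have h : ⁅pderiv (R := ℝ) i, pderiv (R := ℝ) j⁆ = 0 := by
    refine MvPolynomial.derivation_ext fun k => ?_
    rw [Derivation.commutator_apply]
    simp only [pderiv_X, Pi.single_apply]
    split_ifs <;> simp
  have := congrArg (fun D => D p) h
  rw [Derivation.commutator_apply] at this
  exact sub_eq_zero.1 this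

variable [Fintype σ]

/-- The Hessian form of `p` at every positive point `a` satisfies the reversed Cauchy-Schwarz
inequality against `a`. -/
def ReversedCauchy (p : MvPolynomial σ ℝ) : Prop :=
  ∀ a : σ → ℝ, (∀ i, 0 < a i) → ∀ x : σ → ℝ,
    (∑ i, ∑ j, eval a (pderiv i (pderiv j p)) * x i * x j) *
        (∑ i, ∑ j, eval a (pderiv i (pderiv j p)) * a i * a j) ≤
      (∑ i, ∑ j, eval a (pderiv i (pderiv j p)) * x i * a j) ^ 2

theorem euler_eval {p : MvPolynomial σ ℝ} {d : ℕ} (hp : p.IsHomogeneous d) (a : σ → ℝ) :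
    ∑ i, eval a (pderiv i p) * a i = d * eval a p := by
  have := congrArg (eval a) hp.sum_X_mul_pderiv
  simp only [map_sum, map_mul, eval_X, nsmul_eq_mul, map_natCast] at this
  rw [← this]
  exact Finset.sum_congr rfl fun i _ => mul_comm _ _

/-- By Euler's formula the Hessian of `p` at `a` is, up to the factor `d + 1`, the sum of the
Hessians of the `∂_i p` weighted by `a i`. Bounding each summand by its own reversed Cauchy-Schwarz
inequality yields the local hypothesis of `quadratic_nonpos_of_local`. -/
theorem reversedCauchy_of_pderiv {p : MvPolynomial σ ℝ} {d : ℕ} (hp : p.IsHomogeneous (d + 3))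
    (hn2 : ∀ a : σ → ℝ, (∀ i, 0 < a i) → ∀ i j, 0 ≤ eval a (pderiv i (pderiv j p)))
    (hn3 : ∀ a : σ → ℝ, (∀ i, 0 < a i) → ∀ i j k,
      0 ≤ eval a (pderiv i (pderiv j (pderiv k p))))
    (hconn : ∀ a : σ → ℝ, (∀ i, 0 < a i) → ∀ u : σ → ℝ,
      (∀ i j, 0 < eval a (pderiv i (pderiv j p)) → u i = u j) →
      ∀ i j k l, 0 < eval a (pderiv i (pderiv k p)) → 0 < eval a (pderiv j (pderiv l p)) →
        u i = u j)
    (hder : ∀ i, ReversedCauchy (pderiv i p)) : ReversedCauchy p := by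
  intro a ha
  have hs : ∀ i j, eval a (pderiv i (pderiv j p)) = eval a (pderiv j (pderiv i p)) :=
    fun i j => by rw [pderiv_pderiv_comm]
  have hp1 : ∀ i, (pderiv i p).IsHomogeneous (d + 2) := fun i => hp.pderiv
  have hp2 : ∀ i j, (pderiv i (pderiv j p)).IsHomogeneous (d + 1) := fun i j => (hp1 j).pderiv
  refine reversed_cauchy_of_nonpos _ hs a ?_ ?_
  · exact Finset.sum_nonneg fun i _ => Finset.sum_nonneg fun j _ =>
      mul_nonneg (mul_nonneg (hn2 a ha i j) (ha i).le) (ha j).le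
  refine quadratic_nonpos_of_local _ hs (hn2 a ha) a ha (hconn a ha) fun x => ?_
  have e1 : ∀ i k, ∑ j, eval a (pderiv j (pderiv k (pderiv i p))) * a j =
      (d + 1) * eval a (pderiv i (pderiv k p)) := by
    intro i k
    have := euler_eval (hp2 k i) a
    rw [this, pderiv_pderiv_comm]
    push_cast; ring
  have e2 : ∀ (i : σ) (y : σ → ℝ),
      ∑ j, ∑ k, eval a (pderiv j (pderiv k (pderiv i p))) * y j * a k =
      (d + 1) * ∑ j, eval a (pderiv i (pderiv j p)) * y j := by
    intro i y
    rw [Finset.mul_sum]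
    refine Finset.sum_congr rfl fun j _ => ?_
    rw [← mul_assoc, ← e1, Finset.sum_mul]
    refine Finset.sum_congr rfl fun k _ => ?_
    rw [pderiv_pderiv_comm j k]; ring
  have e3 : ∑ i, a i * ∑ j, ∑ k, eval a (pderiv j (pderiv k (pderiv i p))) * x j * x k =
      (d + 1) * ∑ j, ∑ k, eval a (pderiv j (pderiv k p)) * x j * x k := by
    have h : ∀ j k, ∑ i, eval a (pderiv i (pderiv j (pderiv k p))) * a i =
        (d + 1) * eval a (pderiv j (pderiv k p)) := by
      intro j k
      rw [euler_eval (hp2 j k) a]; push_cast; ring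
    simp only [Finset.mul_sum]
    rw [Finset.sum_comm]
    refine Finset.sum_congr rfl fun j _ => ?_
    rw [Finset.sum_comm]
    refine Finset.sum_congr rfl fun k _ => ?_
    rw [← mul_assoc, ← mul_assoc, ← h, Finset.sum_mul, Finset.sum_mul]
    refine Finset.sum_congr rfl fun i _ => ?_
    rw [pderiv_pderiv_comm k i, pderiv_pderiv_comm j i]; ring
  have hd : (0 : ℝ) < d + 1 := by positivity
  have key : ∀ i, ∑ j, ∑ k, eval a (pderiv j (pderiv k (pderiv i p))) * x j * x k ≤
      (d + 1) * ((∑ j, eval a (pderiv i (pderiv j p)) * x j) ^ 2 /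
        (∑ j, eval a (pderiv i (pderiv j p)) * a j)) := by
    intro i
    have h1 := hder i a ha x
    rw [e2, e2] at h1
    have hb : 0 ≤ ∑ j, eval a (pderiv i (pderiv j p)) * a j :=
      Finset.sum_nonneg fun j _ => mul_nonneg (hn2 a ha i j) (ha j).le
    rcases hb.eq_or_lt with h0 | h0
    -- A vanishing denominator forces the whole nonnegative Hessian of `∂_i p` at `a` to vanish,
    -- which agrees with the convention that division by zero gives zero.
    · have hz := e2 i a
      rw [← h0, mul_zero] at hz
      have hnn : ∀ j k, 0 ≤ eval a (pderiv j (pderiv k (pderiv i p))) * a j * a k :=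
        fun j k => mul_nonneg (mul_nonneg (hn3 a ha j k i) (ha j).le) (ha k).le
      have hz' : ∀ j k, eval a (pderiv j (pderiv k (pderiv i p))) = 0 := by
        intro j k
        have h2 := (Finset.sum_eq_zero_iff_of_nonneg (fun j _ => Finset.sum_nonneg
          fun k _ => hnn j k)).1 hz j (Finset.mem_univ j)
        have h3 := (Finset.sum_eq_zero_iff_of_nonneg (fun k _ => hnn j k)).1 h2 k
          (Finset.mem_univ k)
        exact (mul_eq_zero.1 ((mul_eq_zero.1 h3).resolve_right (ha k).ne')).resolve_right
          (ha j).ne'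
      rw [← h0, div_zero, mul_zero]
      simp [hz']
    · rw [← mul_div_assoc, le_div_iff₀ h0]
      refine le_of_mul_le_mul_left ?_ hd
      nlinarith [h1]
  have h4 : (d + 1 : ℝ) * ∑ j, ∑ k, eval a (pderiv j (pderiv k p)) * x j * x k ≤
      (d + 1) * ∑ i, a i * (∑ j, eval a (pderiv i (pderiv j p)) * x j) ^ 2 /
        (∑ j, eval a (pderiv i (pderiv j p)) * a j) := by
    rw [← e3, Finset.mul_sum]
    refine Finset.sum_le_sum fun i _ => ?_
    refine (mul_le_mul_of_nonneg_left (key i) (ha i).le).trans (le_of_eq ?_)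
    ring
  exact le_of_mul_le_mul_left h4 hd

/-- The infinitesimal form of log-concavity, for homogeneous polynomials. -/
theorem eval_mul_hessian_le {p : MvPolynomial σ ℝ} {d : ℕ} (hp : p.IsHomogeneous d)
    (hrc : 2 ≤ d → ReversedCauchy p) (a : σ → ℝ) (ha : ∀ i, 0 < a i)
    (x : σ → ℝ) :
    eval a p * (∑ i, ∑ j, eval a (pderiv i (pderiv j p)) * x i * x j) ≤
      (∑ i, eval a (pderiv i p) * x i) ^ 2 := by
  have e1 : ∀ y : σ → ℝ, ∑ i, ∑ j, eval a (pderiv i (pderiv j p)) * y i * a j =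
      ((d - 1 : ℕ) : ℝ) * ∑ i, eval a (pderiv i p) * y i := by
    intro y
    rw [Finset.mul_sum]
    refine Finset.sum_congr rfl fun i _ => ?_
    rw [← mul_assoc, ← euler_eval (hp.pderiv (i := i)) a, Finset.sum_mul]
    refine Finset.sum_congr rfl fun j _ => ?_
    rw [pderiv_pderiv_comm i j]; ring
  obtain hd | ⟨e, rfl⟩ : d < 2 ∨ ∃ e, d = e + 2 := by
    rcases lt_or_ge d 2 with h | h
    · exact Or.inl h
    · exact Or.inr ⟨d - 2, by omega⟩
  · have hz : ∀ i j, pderiv i (pderiv j p) = 0 := by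
      intro i j
      have h1 : (pderiv j p).IsHomogeneous 0 := by
        have := hp.pderiv (i := j)
        rwa [show d - 1 = 0 by omega] at this
      rw [← totalDegree_zero_iff_isHomogeneous, totalDegree_eq_zero_iff_eq_C] at h1
      rw [h1, pderiv_C]
    simp only [hz, map_zero, zero_mul, Finset.sum_const_zero, mul_zero]
    positivity
  · have h1 := hrc (by omega) a ha x
    rw [e1, e1, euler_eval hp a] at h1
    push_cast [show e + 2 - 1 = e + 1 by omega] at h1
    set s := ∑ i, ∑ j, eval a (pderiv i (pderiv j p)) * x i * x j
    set l := ∑ i, eval a (pderiv i p) * x i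
    have he : (0 : ℝ) < e + 1 := by positivity
    -- In degree `d = e + 2`, Euler's formula turns reversed Cauchy-Schwarz into `d (d - 1) p s ≤ (d
    -- - 1)² l²`.
    have h2 : (e + 2 : ℝ) * (eval a p * s) ≤ (e + 1) * l ^ 2 := by
      refine le_of_mul_le_mul_left ?_ he
      linarith
    have h3 : (e + 2 : ℝ) * (eval a p * s) ≤ (e + 2) * l ^ 2 := by nlinarith [sq_nonneg l]
    exact le_of_mul_le_mul_left h3 (by positivity)

theorem hasDerivAt_eval_line (p : MvPolynomial σ ℝ) (x v : σ → ℝ) (t : ℝ) :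
    HasDerivAt (fun t : ℝ => eval (x + t • v) p)
      (∑ i, eval (x + t • v) (pderiv i p) * v i) t := by
  classical
  induction p using MvPolynomial.induction_on with
  | C c => simpa using hasDerivAt_const t c
  | add p q hp hq =>
    simp only [map_add, add_mul, Finset.sum_add_distrib]
    exact hp.add hq
  | mul_X p k hp =>
    have hX : HasDerivAt (fun t : ℝ => x k + t * v k) (v k) t := by
      simpa using ((hasDerivAt_id t).mul_const (v k)).const_add (x k)
    have := hp.mul hX
    simp only [map_mul, eval_X, Pi.add_apply, Pi.smul_apply, smul_eq_mul]
    refine this.congr_deriv ?_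
    simp only [pderiv_mul, pderiv_X, Pi.single_apply, map_add, map_mul, eval_X, Pi.add_apply,
      Pi.smul_apply, smul_eq_mul, add_mul, Finset.sum_add_distrib, Finset.sum_mul]
    congr 1
    · exact Finset.sum_congr rfl fun i _ => by ring
    · rw [Finset.sum_eq_single k]
      · simp
      · intro i _ hi; simp [hi.symm]
      · simp

theorem concaveOn_log_eval {p : MvPolynomial σ ℝ}
    (hpos : ∀ a : σ → ℝ, (∀ i, 0 < a i) → 0 < eval a p)
    (h : ∀ a : σ → ℝ, (∀ i, 0 < a i) → ∀ x : σ → ℝ,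
      eval a p * (∑ i, ∑ j, eval a (pderiv i (pderiv j p)) * x i * x j) ≤
        (∑ i, eval a (pderiv i p) * x i) ^ 2) :
    ConcaveOn ℝ {w : σ → ℝ | ∀ i, 0 < w i} (fun w => Real.log (eval w p)) := by
  have hconv : Convex ℝ {w : σ → ℝ | ∀ i, 0 < w i} := by
    intro x hx y hy s t hs ht hst i
    have h1 := hx i
    have h2 := hy i
    simp only [Pi.add_apply, Pi.smul_apply, smul_eq_mul]
    rcases hs.eq_or_lt with rfl | hs
    · rw [zero_add] at hst; subst hst; simpa using h2
    · exact add_pos_of_pos_of_nonneg (mul_pos hs h1) (mul_nonneg ht h2.le)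
  refine ⟨hconv, ?_⟩
  intro x hx y hy s t hs ht hst
  set v := y - x with hv
  have hmem : ∀ r ∈ Set.Icc (0 : ℝ) 1, ∀ i, 0 < (x + r • v) i := by
    intro r hr
    have := hconv hx hy (sub_nonneg.2 hr.2) hr.1 (by ring)
    have e : (1 - r) • x + r • y = x + r • v := by
      rw [hv]; module
    rw [e] at this
    exact this
  have hcc : ConcaveOn ℝ (Set.Icc (0 : ℝ) 1) (fun r => Real.log (eval (x + r • v) p)) := by
    have hd1 : ∀ r ∈ Set.Icc (0 : ℝ) 1,
        HasDerivAt (fun r : ℝ => Real.log (eval (x + r • v) p))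
          ((∑ i, eval (x + r • v) (pderiv i p) * v i) / eval (x + r • v) p) r := fun r hr =>
      (hasDerivAt_eval_line p x v r).log (hpos _ (hmem r hr)).ne'
    refine concaveOn_of_hasDerivWithinAt2_nonpos (convex_Icc 0 1)
      (f' := fun r => (∑ i, eval (x + r • v) (pderiv i p) * v i) / eval (x + r • v) p)
      (f'' := fun r => ((∑ i, (∑ j, eval (x + r • v) (pderiv j (pderiv i p)) * v j) * v i) *
        eval (x + r • v) p - (∑ i, eval (x + r • v) (pderiv i p) * v i) *
          (∑ i, eval (x + r • v) (pderiv i p) * v i)) / eval (x + r • v) p ^ 2)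
      (fun r hr => (hd1 r hr).continuousAt.continuousWithinAt) ?_ ?_ ?_
    · intro r hr
      exact (hd1 r (interior_subset hr)).hasDerivWithinAt
    · intro r hr
      refine HasDerivAt.hasDerivWithinAt ?_
      refine HasDerivAt.div ?_ (hasDerivAt_eval_line p x v r)
        (hpos _ (hmem r (interior_subset hr))).ne'
      exact HasDerivAt.fun_sum fun i _ => (hasDerivAt_eval_line (pderiv i p) x v r).mul_const _
    · intro r hr
      refine div_nonpos_of_nonpos_of_nonneg ?_ (sq_nonneg _)
      have h1 := h _ (hmem r (interior_subset hr)) v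
      have h2 : ∑ i, (∑ j, eval (x + r • v) (pderiv j (pderiv i p)) * v j) * v i =
          ∑ i, ∑ j, eval (x + r • v) (pderiv i (pderiv j p)) * v i * v j := by
        refine Finset.sum_congr rfl fun i _ => ?_
        rw [Finset.sum_mul]
        refine Finset.sum_congr rfl fun j _ => ?_
        rw [pderiv_pderiv_comm j i]; ring
      rw [h2]
      nlinarith
  have := hcc.2 (Set.left_mem_Icc.2 zero_le_one) (Set.right_mem_Icc.2 zero_le_one) hs ht hst
  have e1 : x + (s • (0 : ℝ) + t • (1 : ℝ)) • v = s • x + t • y := by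
    have : s = 1 - t := by linarith
    rw [hv, this]; simp only [smul_eq_mul, mul_zero, mul_one, zero_add]; module
  have e2 : x + (0 : ℝ) • v = x := by simp
  have e3 : x + (1 : ℝ) • v = y := by rw [hv]; simp
  simp only [e1, e2, e3] at this
  exact this

end Hessian

theorem sum_equal_value_eq {E γ : Type*} [DecidableEq γ] (g : E → γ) (A : Finset E) (x : E → ℝ) :
    ∑ i ∈ A, ∑ j ∈ A, (if g i = g j then x i * x j else 0) =
      ∑ c ∈ A.image g, (∑ i ∈ A with g i = c, x i) ^ 2 := by
  have h : ∀ c, (∑ i ∈ A with g i = c, x i) ^ 2 =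
      ∑ i ∈ A, ∑ j ∈ A, if g i = c then (if g j = c then x i * x j else 0) else 0 := by
    intro c
    rw [Finset.sum_filter, sq, Finset.sum_mul_sum]
    refine Finset.sum_congr rfl fun i _ => Finset.sum_congr rfl fun j _ => ?_
    split_ifs <;> simp
  simp only [h]
  conv_rhs => rw [Finset.sum_comm]
  refine Finset.sum_congr rfl fun i hi => ?_
  rw [Finset.sum_comm]
  refine Finset.sum_congr rfl fun j _ => ?_
  rw [Finset.sum_ite_eq, if_pos (Finset.mem_image_of_mem g hi)]
  simp only [eq_comm]

/-! ### Rank functions, contraction, quotients and parallel classes. -/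

section Rank

variable {E : Type*} [DecidableEq E]

/-- The axioms of a matroid rank function, without the normalization `r ∅ = 0`. -/
structure IsRank (r : Finset E → ℕ) : Prop where
  mono : ∀ S T, S ⊆ T → r S ≤ r T
  submod : ∀ S T, r (S ∩ T) + r (S ∪ T) ≤ r S + r T
  insert_le : ∀ i S, r (insert i S) ≤ r S + 1

/-- The rank function obtained by contracting `i`. -/
def contract (i : E) (r : Finset E → ℕ) (S : Finset E) : ℕ := r (insert i S)

theorem IsRank.contract {r : Finset E → ℕ} (hr : IsRank r) (i : E) : IsRank (contract i r) where
  mono S T h := hr.mono _ _ (Finset.insert_subset_insert i h)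
  submod S T := by
    have := hr.submod (insert i S) (insert i T)
    rwa [← Finset.insert_inter_distrib, ← Finset.insert_union_distrib] at this
  insert_le j S := by
    unfold MatroidMorphism.contract
    rw [Finset.insert_comm]
    exact hr.insert_le _ _

theorem IsRank.union_le_add_card {r : Finset E → ℕ} (hr : IsRank r) (S T : Finset E) :
    r (S ∪ T) ≤ r S + T.card := by
  induction T using Finset.induction_on with
  | empty => simp
  | insert i T hi ih =>
    rw [Finset.union_insert, Finset.card_insert_of_notMem hi]
    have := hr.insert_le i (S ∪ T)
    omega

theorem IsRank.le_card {r : Finset E → ℕ} (hr : IsRank r) (S : Finset E) :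
    r S ≤ r ∅ + S.card := by
  simpa using hr.union_le_add_card ∅ S

theorem IsRank.indep_subset {r : Finset E → ℕ} (hr : IsRank r) {S T : Finset E} (hTS : T ⊆ S)
    (hS : r S = r ∅ + S.card) : r T = r ∅ + T.card := by
  have h1 := hr.union_le_add_card T (S \ T)
  rw [Finset.union_sdiff_of_subset hTS, Finset.card_sdiff_of_subset hTS] at h1
  have h2 := hr.le_card T
  have h3 := Finset.card_le_card hTS
  omega

theorem IsRank.union_add_empty_le {r : Finset E → ℕ} (hr : IsRank r) (S T : Finset E) :
    r (S ∪ T) + r ∅ ≤ r S + r T := by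
  have h1 := hr.submod S T
  have h2 := hr.mono ∅ (S ∩ T) (Finset.empty_subset _)
  omega

theorem IsRank.pair_facts {r : Finset E → ℕ} (hr : IsRank r) (i j : E) :
    r ∅ ≤ r {i} ∧ r ∅ ≤ r {j} ∧ r {i} ≤ r ∅ + 1 ∧ r {j} ≤ r ∅ + 1 ∧ r {i} ≤ r {i, j} ∧
      r {j} ≤ r {i, j} ∧ r {i, j} + r ∅ ≤ r {i} + r {j} := by
  refine ⟨hr.mono _ _ (by simp), hr.mono _ _ (by simp), ?_, ?_, hr.mono _ _ (by simp),
    hr.mono _ _ (by simp), hr.union_add_empty_le {i} {j}⟩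
  · simpa using hr.insert_le i ∅
  · simpa using hr.insert_le j ∅

/-- If no element of `S` increases the rank of `B`, then neither does `S`. -/
theorem IsRank.union_eq_of_forall_insert {r : Finset E → ℕ} (hr : IsRank r) (B S : Finset E)
    (h : ∀ j ∈ S, r (insert j B) ≤ r B) : r (B ∪ S) ≤ r B := by
  induction S using Finset.induction_on with
  | empty => simp
  | insert i S hi ih =>
    have h1 := ih fun j hj => h j (Finset.mem_insert_of_mem hj)
    have h2 := h i (Finset.mem_insert_self _ _)
    have h3 := hr.submod (B ∪ S) (insert i B)
    have h4 := hr.mono B ((B ∪ S) ∩ insert i B)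
      (Finset.subset_inter Finset.subset_union_left (Finset.subset_insert _ _))
    have h5 : (B ∪ S) ∪ insert i B = B ∪ insert i S := by
      ext k; simp only [Finset.mem_union, Finset.mem_insert]; tauto
    rw [h5] at h3
    omega

/-- Every independent subset of `S` extends to an independent subset of `S` of full rank. -/
theorem IsRank.exists_basis {r : Finset E → ℕ} (hr : IsRank r) {I S : Finset E} (hIS : I ⊆ S)
    (hI : r I = r ∅ + I.card) :
    ∃ B, I ⊆ B ∧ B ⊆ S ∧ r B = r ∅ + B.card ∧ r B = r S := by
  obtain ⟨B, hB, hmax⟩ := Finset.exists_max_image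
    (S.powerset.filter fun B => I ⊆ B ∧ r B = r ∅ + B.card) Finset.card
    ⟨I, by simp [hIS, hI]⟩
  simp only [Finset.mem_filter, Finset.mem_powerset] at hB hmax
  obtain ⟨hBS, hIB, hBi⟩ := hB
  refine ⟨B, hIB, hBS, hBi, le_antisymm (hr.mono _ _ hBS) ?_⟩
  have := hr.union_eq_of_forall_insert B S fun j hj => by
    by_contra! h
    have hjB : j ∉ B := fun hjB => by simp [Finset.insert_eq_of_mem hjB] at h
    have h1 := hr.insert_le j B
    have h2 := hmax (insert j B) ⟨Finset.insert_subset hj hBS,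
      hIB.trans (Finset.subset_insert _ _), by rw [Finset.card_insert_of_notMem hjB]; omega⟩
    rw [Finset.card_insert_of_notMem hjB] at h2
    omega
  rwa [Finset.union_eq_right.2 hBS] at this

/-- `r` and `q` are rank functions, `q` is a quotient of `r`, and `q` is bounded by `R`. -/
structure IsQuotientPair (r q : Finset E → ℕ) (R : ℕ) : Prop where
  rank : IsRank r
  rank_quot : IsRank q
  quot : ∀ S T, S ⊆ T → q T + r S ≤ q S + r T
  le : ∀ S, q S ≤ R

theorem IsQuotientPair.contract {r q : Finset E → ℕ} {R : ℕ} (h : IsQuotientPair r q R) (i : E) :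
    IsQuotientPair (contract i r) (contract i q) R where
  rank := h.rank.contract i
  rank_quot := h.rank_quot.contract i
  quot _ _ hST := h.quot _ _ (Finset.insert_subset_insert i hST)
  le _ := h.le _

/-- `S` is independent for `r` and has `q`-rank `R`. -/
abbrev IsQuotientBasis (r q : Finset E → ℕ) (R : ℕ) (S : Finset E) : Prop :=
  r S = r ∅ + S.card ∧ q S = R

/-- Independence is measured relative to `r ∅`, so contraction needs no subtraction and leaves `R`
unchanged. Sets containing `i` drop out because `i` is a loop of the contraction. -/
theorem isQuotientBasis_contract {r q : Finset E → ℕ} {R : ℕ} (hr : IsRank r) {i : E}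
    (hi : r {i} = r ∅ + 1) (S : Finset E) :
    IsQuotientBasis (contract i r) (contract i q) R S ↔
      i ∉ S ∧ IsQuotientBasis r q R (insert i S) := by
  unfold IsQuotientBasis contract
  rw [insert_empty_eq, hi]
  by_cases hS : i ∈ S
  · have := hr.le_card S
    simp only [hS, not_true_eq_false, false_and, iff_false, Finset.insert_eq_of_mem]
    omega
  · rw [Finset.card_insert_of_notMem hS]
    simp only [hS, not_false_eq_true, true_and]
    constructor <;> rintro ⟨h1, h2⟩ <;> exact ⟨by omega, h2⟩

theorem IsRank.nonloop_of_indep {r : Finset E → ℕ} (hr : IsRank r) {S : Finset E}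
    (hS : r S = r ∅ + S.card) {i : E} (hi : i ∈ S) : r {i} = r ∅ + 1 := by
  simpa using hr.indep_subset (Finset.singleton_subset_iff.2 hi) hS

variable [Fintype E]

/-- The quadratic form of the parallelism relation of a matroid is positive semidefinite, and
bounds the square of the sum over the nonloops. -/
theorem IsRank.parallel_form {r : Finset E → ℕ} (hr : IsRank r) (x : E → ℝ) :
    0 ≤ ∑ i, ∑ j, (if r {i} = r ∅ + 1 ∧ r {j} = r ∅ + 1 ∧ r {i, j} = r ∅ + 1 then (1 : ℝ) else 0) *
        x i * x j ∧
    (∑ i, (if r {i} = r ∅ + 1 then (1 : ℝ) else 0) * x i) ^ 2 ≤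
      (Finset.univ.filter fun i => r {i} = r ∅ + 1).card *
      ∑ i, ∑ j, (if r {i} = r ∅ + 1 ∧ r {j} = r ∅ + 1 ∧ r {i, j} = r ∅ + 1 then (1 : ℝ) else 0) *
        x i * x j := by
  set A := Finset.univ.filter fun i => r {i} = r ∅ + 1 with hA
  -- `g i` is the parallel class of `i`. The form is the sum over classes of the squared class sums,
  -- and Cauchy-Schwarz applies with at most as many classes as nonloops.
  let g : E → Finset E := fun i => A.filter fun k => r {i, k} = r ∅ + 1
  have hmem : ∀ i, i ∈ A ↔ r {i} = r ∅ + 1 := fun i => by simp [hA]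
  have hg : ∀ i ∈ A, ∀ j ∈ A, (r {i, j} = r ∅ + 1 ↔ g i = g j) := by
    have htrans : ∀ i j k, r {i} = r ∅ + 1 → r {j} = r ∅ + 1 → r {i, j} = r ∅ + 1 →
        r {i, k} = r ∅ + 1 → r {j, k} = r ∅ + 1 := by
      intro i j k hi hj hij hik
      have h1 := hr.submod {i, j} {i, k}
      have h2 := hr.mono {i} ({i, j} ∩ {i, k}) (by simp)
      have h3 := hr.mono {j, k} ({i, j} ∪ {i, k}) (by
        intro l; simp only [Finset.mem_insert, Finset.mem_singleton, Finset.mem_union]; tauto)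
      have h4 := (hr.pair_facts j k).2.2.2.2.1
      omega
    intro i hi j hj
    rw [hmem] at hi hj
    constructor
    · intro hij
      ext k
      simp only [g, Finset.mem_filter, hmem]
      constructor
      · rintro ⟨hk, h⟩
        exact ⟨hk, htrans i j k hi hj hij h⟩
      · rintro ⟨hk, h⟩
        exact ⟨hk, htrans j i k hj hi (by rwa [Finset.pair_comm]) h⟩
    · intro h
      have : j ∈ g i := by rw [h]; simp [g, hmem, hj]
      exact (Finset.mem_filter.1 this).2
  have e1 : ∑ i, ∑ j, (if r {i} = r ∅ + 1 ∧ r {j} = r ∅ + 1 ∧ r {i, j} = r ∅ + 1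
      then (1 : ℝ) else 0) * x i * x j =
      ∑ i ∈ A, ∑ j ∈ A, (if g i = g j then x i * x j else 0) := by
    rw [hA, Finset.sum_filter]
    refine Finset.sum_congr rfl fun i _ => ?_
    split_ifs with hi
    · rw [Finset.sum_filter]
      refine Finset.sum_congr rfl fun j _ => ?_
      by_cases hj : r {j} = r ∅ + 1
      · simp only [hi, hj, true_and, if_true, hg i ((hmem i).2 hi) j ((hmem j).2 hj)]
        split_ifs <;> ring
      · simp [hj]
    · simp [hi]
  have e2 : ∑ i, (if r {i} = r ∅ + 1 then (1 : ℝ) else 0) * x i =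
      ∑ c ∈ A.image g, ∑ i ∈ A with g i = c, x i := by
    rw [Finset.sum_fiberwise_of_maps_to fun i hi => Finset.mem_image_of_mem g hi, hA,
      Finset.sum_filter]
    refine Finset.sum_congr rfl fun i _ => ?_
    split_ifs <;> simp
  rw [e1, e2, sum_equal_value_eq]
  have hnn : 0 ≤ ∑ c ∈ A.image g, (∑ i ∈ A with g i = c, x i) ^ 2 :=
    Finset.sum_nonneg fun c _ => sq_nonneg _
  refine ⟨hnn, sq_sum_le_card_mul_sum_sq.trans ?_⟩
  exact mul_le_mul_of_nonneg_right (by exact_mod_cast Finset.card_image_le) hnn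

end Rank

/-! ### The weighted homogeneous basis polynomials and their derivatives. -/

section BasisPoly

open Nat

theorem pderiv_none_prod {E : Type*} [DecidableEq E] (S : Finset E) :
    pderiv none (∏ i ∈ S, X (some i) : MvPolynomial (Option E) ℝ) = 0 := by
  induction S using Finset.induction_on with
  | empty => simp
  | insert i S hi ih => rw [Finset.prod_insert hi, pderiv_mul, ih]; simp [pderiv_X]

theorem pderiv_some_prod {E : Type*} [DecidableEq E] (i : E) (S : Finset E) :
    pderiv (some i) (∏ j ∈ S, X (some j) : MvPolynomial (Option E) ℝ) =
      if i ∈ S then ∏ j ∈ S.erase i, X (some j) else 0 := by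
  have h0 : ∀ S : Finset E, i ∉ S →
      pderiv (some i) (∏ j ∈ S, X (some j) : MvPolynomial (Option E) ℝ) = 0 := by
    intro S
    induction S using Finset.induction_on with
    | empty => simp
    | insert k S hk ih =>
      intro hi
      simp only [Finset.mem_insert, not_or] at hi
      rw [Finset.prod_insert hk, pderiv_mul, ih hi.2, pderiv_X_of_ne (by simpa using Ne.symm hi.1)]
      simp
  split_ifs with h
  · rw [← Finset.mul_prod_erase S _ h, pderiv_mul, h0 _ (Finset.notMem_erase i S)]
    simp
  · exact h0 S h

variable {E : Type*} [Fintype E]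

/-- The homogenized weighted generating polynomial of the sets of size at most `d` that are
independent for `r` and have `q`-rank `R`. -/
noncomputable def basisPoly (r q : Finset E → ℕ) (R n d : ℕ) : MvPolynomial (Option E) ℝ :=
  ∑ S : Finset E with IsQuotientBasis r q R S ∧ S.card ≤ d,
    C (((n - S.card)! : ℝ) / ((d - S.card)! : ℝ)) * X none ^ (d - S.card) * ∏ i ∈ S, X (some i)

theorem basisPoly_isHomogeneous (r q : Finset E → ℕ) (R n d : ℕ) :
    (basisPoly r q R n d).IsHomogeneous d := by
  refine IsHomogeneous.sum _ _ _ fun S hS => ?_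
  simp only [Finset.mem_filter] at hS
  have h1 : (∏ i ∈ S, X (some i) : MvPolynomial (Option E) ℝ).IsHomogeneous S.card := by
    have := IsHomogeneous.prod S (fun i => (X (some i) : MvPolynomial (Option E) ℝ)) (fun _ => 1)
      fun i _ => isHomogeneous_X ℝ (some i)
    simpa using this
  have h2 := ((isHomogeneous_X_pow (R := ℝ) (none : Option E) (d - S.card)).C_mul
    (((n - S.card)! : ℝ) / ((d - S.card)! : ℝ))).mul h1
  rwa [Nat.sub_add_cancel hS.2.2] at h2

theorem eval_basisPoly (r q : Finset E → ℕ) (R n d : ℕ) (a : Option E → ℝ) :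
    eval a (basisPoly r q R n d) = ∑ S : Finset E with IsQuotientBasis r q R S ∧ S.card ≤ d,
      ((n - S.card)! : ℝ) / ((d - S.card)! : ℝ) * a none ^ (d - S.card) * ∏ i ∈ S, a (some i) := by
  simp [basisPoly, map_sum, map_mul, map_prod]

theorem eval_basisPoly_term_pos {E : Type*} (n d : ℕ) {a : Option E → ℝ} (ha : ∀ v, 0 < a v) (S : Finset E) :
    0 < ((n - S.card)! : ℝ) / ((d - S.card)! : ℝ) * a none ^ (d - S.card) *
      ∏ i ∈ S, a (some i) := by
  have h1 : 0 < ∏ i ∈ S, a (some i) := Finset.prod_pos fun i _ => ha _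
  have h2 := ha none
  positivity

theorem eval_basisPoly_pos {r q : Finset E → ℕ} {R n d : ℕ} {a : Option E → ℝ}
    (ha : ∀ v, 0 < a v) {S : Finset E} (hS : IsQuotientBasis r q R S) (hd : S.card ≤ d) :
    0 < eval a (basisPoly r q R n d) := by
  rw [eval_basisPoly]
  exact Finset.sum_pos (fun T _ => eval_basisPoly_term_pos n d ha T) ⟨S, Finset.mem_filter.2 ⟨Finset.mem_univ _, hS, hd⟩⟩

theorem basisPoly_eq_zero_or_exists (r q : Finset E → ℕ) (R n d : ℕ) :
    basisPoly r q R n d = 0 ∨ ∃ S, IsQuotientBasis r q R S ∧ S.card ≤ d := by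
  by_cases h : ∃ S, IsQuotientBasis r q R S ∧ S.card ≤ d
  · exact Or.inr h
  · push Not at h
    refine Or.inl (Finset.sum_eq_zero fun S hS => ?_)
    simp only [Finset.mem_filter] at hS
    exact absurd hS.2.2 (not_le.2 (h S hS.2.1))

theorem eval_basisPoly_zero (r q : Finset E → ℕ) (R n : ℕ) (a : Option E → ℝ) :
    eval a (basisPoly r q R n 0) = if q ∅ = R then (n ! : ℝ) else 0 := by
  rw [eval_basisPoly, Finset.sum_filter, Finset.sum_eq_single ∅]
  · simp [IsQuotientBasis]
  · intro S _ hS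
    rw [if_neg]
    rintro ⟨_, h⟩
    exact hS (Finset.card_eq_zero.1 (Nat.le_zero.1 h))
  · simp

variable [DecidableEq E]

/-- The denominators make the powers of `w₀` divided powers, which differentiate to one another; the
bases of size `d + 1` are free of `w₀` and disappear. -/
theorem pderiv_none_basisPoly (r q : Finset E → ℕ) (R n d : ℕ) :
    pderiv none (basisPoly r q R n (d + 1)) = basisPoly r q R n d := by
  unfold basisPoly
  rw [map_sum, Finset.sum_filter, Finset.sum_filter]
  refine Finset.sum_congr rfl fun S _ => ?_
  by_cases hB : IsQuotientBasis r q R S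
  swap
  · simp [hB]
  simp only [eq_true hB, true_and]
  rw [pderiv_mul, pderiv_none_prod, mul_zero, add_zero, pderiv_C_mul, pderiv_pow, pderiv_X_self,
    mul_one]
  rcases lt_trichotomy S.card (d + 1) with h | h | h
  · rw [if_pos h.le, if_pos (by omega)]
    obtain ⟨e, he⟩ : ∃ e, d - S.card = e := ⟨_, rfl⟩
    rw [he, show d + 1 - S.card = e + 1 by omega, Nat.factorial_succ, Nat.add_sub_cancel,
      ← mul_assoc, show ((e + 1 : ℕ) : MvPolynomial (Option E) ℝ) = C ((e + 1 : ℕ) : ℝ) by simp,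
      ← C_mul]
    congr 3
    have : (e ! : ℝ) ≠ 0 := by positivity
    have : ((e + 1 : ℕ) : ℝ) ≠ 0 := by positivity
    push_cast at *
    field_simp
  · rw [if_pos h.le, if_neg (by omega)]
    simp [h]
  · rw [if_neg (by omega), if_neg (by omega)]

/-- Removing `i` from a basis lowers its size by one, so lowering `n` and `d` together preserves the
weight. -/
theorem pderiv_some_basisPoly {r q : Finset E → ℕ} (hr : IsRank r) (R n d : ℕ) {i : E}
    (hi : r {i} = r ∅ + 1) :
    pderiv (some i) (basisPoly r q R (n + 1) (d + 1)) =
      basisPoly (contract i r) (contract i q) R n d := by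
  unfold basisPoly
  simp only [isQuotientBasis_contract hr hi]
  rw [map_sum]
  have hterm : ∀ S : Finset E, pderiv (some i) (C (((n + 1 - S.card)! : ℝ) /
      ((d + 1 - S.card)! : ℝ)) * X none ^ (d + 1 - S.card) * ∏ j ∈ S, X (some j)) =
      if i ∈ S then C (((n + 1 - S.card)! : ℝ) / ((d + 1 - S.card)! : ℝ)) *
        X none ^ (d + 1 - S.card) * ∏ j ∈ S.erase i, X (some j) else 0 := by
    intro S
    rw [pderiv_mul, pderiv_C_mul, pderiv_pow, pderiv_X_of_ne (by simp), pderiv_some_prod]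
    split_ifs <;> simp
  simp only [hterm]
  rw [← Finset.sum_filter, Finset.filter_filter]
  refine Finset.sum_nbij' (fun S => S.erase i) (fun S => insert i S) ?_ ?_ ?_ ?_ ?_
  · intro S hS
    simp only [Finset.mem_filter, Finset.mem_univ, true_and] at hS ⊢
    rw [Finset.insert_erase hS.2, Finset.card_erase_of_mem hS.2]
    exact ⟨⟨Finset.notMem_erase i S, hS.1.1⟩, by omega⟩
  · intro S hS
    simp only [Finset.mem_filter, Finset.mem_univ, true_and] at hS ⊢
    rw [Finset.card_insert_of_notMem hS.1.1]
    exact ⟨⟨hS.1.2, by omega⟩, Finset.mem_insert_self i S⟩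
  · intro S hS
    simp only [Finset.mem_filter] at hS
    exact Finset.insert_erase hS.2.2
  · intro S hS
    simp only [Finset.mem_filter] at hS
    exact Finset.erase_insert hS.2.1.1
  · intro S hS
    simp only [Finset.mem_filter] at hS
    have : 0 < S.card := Finset.card_pos.2 ⟨i, hS.2.2⟩
    rw [Finset.card_erase_of_mem hS.2.2, show n + 1 - S.card = n - (S.card - 1) by omega,
      show d + 1 - S.card = d - (S.card - 1) by omega]

theorem pderiv_some_basisPoly_of_loop {r q : Finset E → ℕ} (hr : IsRank r) (R n d : ℕ) {i : E}
    (hi : r {i} ≠ r ∅ + 1) : pderiv (some i) (basisPoly r q R n d) = 0 := by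
  unfold basisPoly
  rw [map_sum]
  refine Finset.sum_eq_zero fun S hS => ?_
  simp only [Finset.mem_filter] at hS
  have : i ∉ S := fun h => hi (hr.nonloop_of_indep hS.2.1.1 h)
  rw [pderiv_mul, pderiv_C_mul, pderiv_pow, pderiv_X_of_ne (by simp), pderiv_some_prod, if_neg this]
  simp

/-- The class of polynomials `basisPoly r q R n d`, together with zero. It is closed under partial
derivatives. -/
def IsBasisPoly (d : ℕ) (p : MvPolynomial (Option E) ℝ) : Prop :=
  p = 0 ∨ ∃ r q R n, IsQuotientPair r q R ∧
    (Finset.univ.filter fun i => r {i} = r ∅ + 1).card ≤ n ∧ d ≤ n ∧ p = basisPoly r q R n d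

theorem IsBasisPoly.isHomogeneous {d : ℕ} {p : MvPolynomial (Option E) ℝ} (hp : IsBasisPoly d p) :
    p.IsHomogeneous d := by
  rcases hp with rfl | ⟨r, q, R, n, -, -, -, rfl⟩
  · exact isHomogeneous_zero _ _ _
  · exact basisPoly_isHomogeneous r q R n d

theorem IsBasisPoly.eq_zero_or_pos {d : ℕ} {p : MvPolynomial (Option E) ℝ}
    (hp : IsBasisPoly d p) : p = 0 ∨ ∀ a : Option E → ℝ, (∀ v, 0 < a v) → 0 < eval a p := by
  rcases hp with rfl | ⟨r, q, R, n, -, -, -, rfl⟩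
  · exact Or.inl rfl
  · refine (basisPoly_eq_zero_or_exists r q R n d).imp_right ?_
    rintro ⟨S, hS, hd⟩ a ha
    exact eval_basisPoly_pos ha hS hd

theorem IsBasisPoly.eval_nonneg {d : ℕ} {p : MvPolynomial (Option E) ℝ}
    (hp : IsBasisPoly d p) {a : Option E → ℝ} (ha : ∀ v, 0 < a v) : 0 ≤ eval a p := by
  rcases hp.eq_zero_or_pos with rfl | h
  · simp
  · exact (h a ha).le

/-- No new nonloops appear and `i` becomes a loop. This strict drop keeps the bound on the nonloops
valid when `n` decreases by one. -/
theorem card_nonloops_contract_lt {r : Finset E → ℕ} (hr : IsRank r) {i : E}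
    (hi : r {i} = r ∅ + 1) :
    (Finset.univ.filter fun j => contract i r {j} = contract i r ∅ + 1).card <
      (Finset.univ.filter fun j => r {j} = r ∅ + 1).card := by
  refine Finset.card_lt_card ((Finset.ssubset_iff_of_subset ?_).2 ⟨i, by simp [hi], ?_⟩)
  · intro j hj
    simp only [Finset.mem_filter, Finset.mem_univ, true_and, contract, insert_empty_eq] at hj ⊢
    have := hr.pair_facts i j
    omega
  · simp [contract]

theorem IsBasisPoly.pderiv {d : ℕ} {p : MvPolynomial (Option E) ℝ} (hp : IsBasisPoly (d + 1) p)
    (v : Option E) : IsBasisPoly d (pderiv v p) := by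
  rcases hp with rfl | ⟨r, q, R, n, h, hc, hd, rfl⟩
  · exact Or.inl (map_zero _)
  cases v with
  | none => exact Or.inr ⟨r, q, R, n, h, hc, by omega, pderiv_none_basisPoly r q R n d⟩
  | some i =>
    by_cases hi : r {i} = r ∅ + 1
    · obtain ⟨m, rfl⟩ : ∃ m, n = m + 1 := ⟨n - 1, by omega⟩
      have := card_nonloops_contract_lt h.rank hi
      exact Or.inr ⟨_, _, R, m, h.contract i, by omega, by omega,
        pderiv_some_basisPoly h.rank R m d hi⟩
    · exact Or.inl (pderiv_some_basisPoly_of_loop h.rank R n (d + 1) hi)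

end BasisPoly

/-! ### The quadratic case. -/

section Quadratic

open Nat

variable {E : Type*} [Fintype E]

theorem sum_option_quadratic (H : Option E → Option E → ℝ) (hs : ∀ v w, H v w = H w v)
    (x : Option E → ℝ) :
    ∑ v, ∑ w, H v w * x v * x w = H none none * x none ^ 2 +
      2 * x none * ∑ i, H none (some i) * x (some i) +
      ∑ i, ∑ j, H (some i) (some j) * x (some i) * x (some j) := by
  simp only [Fintype.sum_option, Finset.sum_add_distrib, Finset.mul_sum, hs (some _) none]
  have : ∑ i, 2 * x none * (H none (some i) * x (some i)) =
      ∑ i, H none (some i) * x none * x (some i) +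
        ∑ i, H none (some i) * x (some i) * x none := by
    rw [← Finset.sum_add_distrib]
    exact Finset.sum_congr rfl fun i _ => by ring
  rw [this]
  ring

theorem sum_mul_sum_form (c e : E → ℝ) (y : E → ℝ) :
    ∑ i, ∑ j, c i * e j * y i * y j = (∑ i, c i * y i) * ∑ j, e j * y j := by
  rw [Finset.sum_mul_sum]
  exact Finset.sum_congr rfl fun i _ => Finset.sum_congr rfl fun j _ => by ring

variable [DecidableEq E]

theorem hessian_none_none (r q : Finset E → ℕ) (R m : ℕ) (a : Option E → ℝ) :
    eval a (pderiv none (pderiv none (basisPoly r q R (m + 2) 2))) =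
      if q ∅ = R then ((m + 2)! : ℝ) else 0 := by
  rw [pderiv_none_basisPoly, pderiv_none_basisPoly, eval_basisPoly_zero]

theorem hessian_none_some {r q : Finset E → ℕ} (hr : IsRank r) (R m : ℕ) (a : Option E → ℝ)
    (i : E) :
    eval a (pderiv none (pderiv (some i) (basisPoly r q R (m + 2) 2))) =
      if r {i} = r ∅ + 1 ∧ q {i} = R then ((m + 1)! : ℝ) else 0 := by
  by_cases hi : r {i} = r ∅ + 1
  · rw [pderiv_some_basisPoly hr R (m + 1) 1 hi, pderiv_none_basisPoly, eval_basisPoly_zero]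
    simp [contract, hi]
  · rw [pderiv_some_basisPoly_of_loop hr R _ _ hi]
    simp [hi]

theorem hessian_some_some {r q : Finset E → ℕ} (hr : IsRank r) (R m : ℕ) (a : Option E → ℝ)
    (i j : E) :
    eval a (pderiv (some i) (pderiv (some j) (basisPoly r q R (m + 2) 2))) =
      if r {i, j} = r ∅ + 2 ∧ q {i, j} = R then (m ! : ℝ) else 0 := by
  have hf := hr.pair_facts i j
  by_cases hj : r {j} = r ∅ + 1
  · rw [pderiv_some_basisPoly hr R (m + 1) 1 hj]
    by_cases hij : contract j r {i} = contract j r ∅ + 1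
    · rw [pderiv_some_basisPoly (hr.contract j) R m 0 hij, eval_basisPoly_zero]
      have h1 : contract i (contract j q) ∅ = q {i, j} := by
        simp only [contract, insert_empty_eq, Finset.pair_comm]
      simp only [contract, insert_empty_eq] at hij
      rw [Finset.pair_comm] at hij
      rw [h1]
      congr 1
      simp only [eq_iff_iff, iff_and_self]
      omega
    · rw [pderiv_some_basisPoly_of_loop (hr.contract j) R _ _ hij, map_zero, if_neg]
      simp only [contract, insert_empty_eq] at hij
      rw [Finset.pair_comm] at hij
      omega
  · rw [pderiv_some_basisPoly_of_loop hr R _ _ hj, map_zero, map_zero, if_neg]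
    omega

/-- The Hessian is constant, and it suffices to find one hyperplane on which it is nonpositive. The
choice depends on the corank `R - q ∅`, since bases of size at most two can raise `q` by at most
two. -/
theorem reversedCauchy_basisPoly_two {r q : Finset E → ℕ} {R m : ℕ} (h : IsQuotientPair r q R)
    (hcard : (Finset.univ.filter fun i => r {i} = r ∅ + 1).card ≤ m + 2) :
    ReversedCauchy (basisPoly r q R (m + 2) 2) := by
  intro a ha
  have hr := h.rank
  have hq := h.rank_quot
  have hs : ∀ v w, eval a (pderiv v (pderiv w (basisPoly r q R (m + 2) 2))) =
    eval a (pderiv w (pderiv v (basisPoly r q R (m + 2) 2))) :=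
      fun v w => by rw [pderiv_pderiv_comm]
  have hmem : IsBasisPoly 2 (basisPoly r q R (m + 2) 2) :=
    Or.inr ⟨r, q, R, m + 2, h, hcard, by omega, rfl⟩
  have hnn : 0 ≤ ∑ v, ∑ w, eval a (pderiv v (pderiv w (basisPoly r q R (m + 2) 2))) * a v * a w :=
    Finset.sum_nonneg fun v _ => Finset.sum_nonneg fun w _ => mul_nonneg (mul_nonneg
      (((hmem.pderiv w).pderiv v).eval_nonneg ha) (ha v).le) (ha w).le
  have hform : ∀ x : Option E → ℝ,
      ∑ v, ∑ w, eval a (pderiv v (pderiv w (basisPoly r q R (m + 2) 2))) * x v * x w =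
      (if q ∅ = R then ((m + 2)! : ℝ) else 0) * x none ^ 2 +
      2 * x none * ∑ i, (if r {i} = r ∅ + 1 ∧ q {i} = R then ((m + 1)! : ℝ) else 0) * x (some i) +
      ∑ i, ∑ j, (if r {i, j} = r ∅ + 2 ∧ q {i, j} = R then (m ! : ℝ) else 0) *
        x (some i) * x (some j) := by
    intro x
    rw [sum_option_quadratic _ hs]
    simp only [hessian_none_none, hessian_none_some hr, hessian_some_some hr]
  have hm : (0 : ℝ) < m ! := by positivity
  have hm1 : ((m + 1)! : ℝ) = (m + 1) * m ! := by rw [Nat.factorial_succ]; push_cast; ring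
  have hm2 : ((m + 2)! : ℝ) = (m + 2) * (m + 1) * m ! := by
    rw [Nat.factorial_succ, Nat.factorial_succ]; push_cast; ring
  have hqe : ∀ S, q ∅ ≤ q S := fun S => hq.mono _ _ (Finset.empty_subset S)
  have hR := h.le ∅
  obtain hk | hk | hk | hk : q ∅ = R ∨ q ∅ + 1 = R ∨ q ∅ + 2 = R ∨ q ∅ + 3 ≤ R := by omega
  · have hqR : ∀ S, q S = R := fun S => le_antisymm (h.le S) (hk ▸ hqe S)
    let ρ : E → ℝ := fun i => if r {i} = r ∅ + 1 then 1 else 0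
    -- The hyperplane is the Hessian-orthogonal complement of the `w₀`-axis: the row of `none`
    -- divided by `(m + 1)!`.
    refine reversed_cauchy_of_hyperplane _ hs a
      (fun v => v.elim ((m : ℝ) + 2) ρ) hnn fun x hx => ?_
    rw [Fintype.sum_option] at hx
    simp only [Option.elim_none, Option.elim_some] at hx
    rw [hform]
    simp only [hqR, and_true, if_true]
    set y : E → ℝ := fun i => x (some i) with hy
    obtain ⟨-, hP2⟩ := hr.parallel_form y
    set P := ∑ i, ∑ j, (if r {i} = r ∅ + 1 ∧ r {j} = r ∅ + 1 ∧ r {i, j} = r ∅ + 1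
      then (1 : ℝ) else 0) * y i * y j with hP
    set l := ∑ i, ρ i * y i with hl
    have e1 : ∑ i, (if r {i} = r ∅ + 1 then ((m + 1)! : ℝ) else 0) * y i = (m + 1) * m ! * l := by
      rw [hl, Finset.mul_sum]
      refine Finset.sum_congr rfl fun i _ => ?_
      simp only [ρ, hm1]
      split_ifs <;> ring
    have e2 : ∑ i, ∑ j, (if r {i, j} = r ∅ + 2 then (m ! : ℝ) else 0) * y i * y j =
        m ! * (l * l - P) := by
      rw [hl, ← sum_mul_sum_form, hP]
      simp only [← Finset.sum_sub_distrib, Finset.mul_sum]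
      refine Finset.sum_congr rfl fun i _ => Finset.sum_congr rfl fun j _ => ?_
      have hf := hr.pair_facts i j
      rw [← sub_mul, ← sub_mul, ← mul_assoc, ← mul_assoc]
      congr 2
      simp only [ρ]
      split_ifs <;> first | omega | simp
    change _ * _ + 2 * x none * ∑ i, _ * y i + ∑ i, ∑ j, _ * y i * y j ≤ 0
    change _ + l = 0 at hx
    rw [e1, e2, hm2]
    have hl0 : l = -((m + 2) * x none) := by linarith
    have hP0 : (0 : ℝ) ≤ P := (hr.parallel_form y).1
    -- The bound `n = m + 2` on the nonloops enters here; together with `l = -(m + 2) x₀` it gives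
    -- exactly `(m + 2) x₀² ≤ P`.
    have hP3 : l ^ 2 ≤ ((m : ℝ) + 2) * P := by
      refine hP2.trans (mul_le_mul_of_nonneg_right ?_ hP0)
      exact_mod_cast hcard
    have hP4 : ((m : ℝ) + 2) * x none ^ 2 ≤ P := by
      have : (0 : ℝ) < m + 2 := by positivity
      refine le_of_mul_le_mul_left ?_ this
      rw [hl0] at hP3
      linarith
    have : (m + 2) * (m + 1) * (m ! : ℝ) * x none ^ 2 +
        2 * x none * ((m + 1) * m ! * l) + m ! * (l * l - P) =
        m ! * ((m + 2) * x none ^ 2 - P) := by rw [hl0]; ring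
    rw [this]
    exact mul_nonpos_of_nonneg_of_nonpos hm.le (by linarith)
  · let α : E → ℝ := fun i => if q {i} = q ∅ + 1 then 1 else 0
    let β : E → ℝ := fun i => if r {i} = r ∅ + 1 ∧ q {i} = q ∅ then 1 else 0
    refine reversed_cauchy_of_hyperplane _ hs a (fun v => v.elim 0 α) hnn fun x hx => ?_
    rw [Fintype.sum_option] at hx
    simp only [Option.elim_none, Option.elim_some, zero_mul, zero_add] at hx
    rw [hform, if_neg (by omega), zero_mul, zero_add]
    set y : E → ℝ := fun i => x (some i) with hy
    change ∑ i, α i * y i = 0 at hx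
    have hP1 := (hr.parallel_form fun i => α i * y i).1
    have hquot : ∀ i, q {i} + r ∅ ≤ q ∅ + r {i} := fun i => h.quot _ _ (by simp)
    have e1 : ∑ i, (if r {i} = r ∅ + 1 ∧ q {i} = R then ((m + 1)! : ℝ) else 0) * y i = 0 := by
      trans ((m + 1)! : ℝ) * ∑ i, α i * y i
      swap
      · rw [hx, mul_zero]
      rw [Finset.mul_sum]
      refine Finset.sum_congr rfl fun i _ => ?_
      have := hquot i
      have hf := hr.pair_facts i i
      rw [← mul_assoc]
      congr 1
      simp only [α]
      split_ifs <;> first | omega | simp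
    -- A basis `{i, j}` needs an element that is not a `q`-loop, so pairs within the support of `β`
    -- do not count. By the quotient property `r`-parallel elements are both `q`-loops or both
    -- `q`-nonloops, so only parallel pairs within the support of `α` are subtracted.
    have e2 : ∑ i, ∑ j, (if r {i, j} = r ∅ + 2 ∧ q {i, j} = R then (m ! : ℝ) else 0) *
        y i * y j = m ! * ((∑ i, α i * y i) * (∑ i, α i * y i) +
          (∑ i, α i * y i) * (∑ i, β i * y i) + (∑ i, β i * y i) * (∑ i, α i * y i) -
          ∑ i, ∑ j, (if r {i} = r ∅ + 1 ∧ r {j} = r ∅ + 1 ∧ r {i, j} = r ∅ + 1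
            then (1 : ℝ) else 0) * (α i * y i) * (α j * y j)) := by
      rw [← sum_mul_sum_form α α, ← sum_mul_sum_form α β, ← sum_mul_sum_form β α]
      simp only [← Finset.sum_sub_distrib, ← Finset.sum_add_distrib, Finset.mul_sum]
      refine Finset.sum_congr rfl fun i _ => Finset.sum_congr rfl fun j _ => ?_
      have hf := hr.pair_facts i j
      have hg := hq.pair_facts i j
      have hi := hquot i
      have hj := hquot j
      have hij := h.quot {i} {i, j} (by simp)
      have hji := h.quot {j} {i, j} (by simp)
      have hle := h.le {i, j}
      have : (if r {i, j} = r ∅ + 2 ∧ q {i, j} = R then (m ! : ℝ) else 0) =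
          m ! * (α i * α j + α i * β j + β i * α j - (if r {i} = r ∅ + 1 ∧ r {j} = r ∅ + 1 ∧
            r {i, j} = r ∅ + 1 then (1 : ℝ) else 0) * α i * α j) := by
        simp only [α, β]
        split_ifs <;> first | omega | simp
      rw [this]
      ring
    change 2 * x none * ∑ i, _ * y i + ∑ i, ∑ j, _ * y i * y j ≤ 0
    rw [e1, e2, hx]
    have := mul_nonneg hm.le hP1
    linarith
  · let α : E → ℝ := fun i => if q {i} = q ∅ + 1 then 1 else 0
    refine reversed_cauchy_of_hyperplane _ hs a (fun v => v.elim 0 α) hnn fun x hx => ?_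
    rw [Fintype.sum_option] at hx
    simp only [Option.elim_none, Option.elim_some, zero_mul, zero_add] at hx
    rw [hform, if_neg (by omega), zero_mul, zero_add]
    set y : E → ℝ := fun i => x (some i) with hy
    change ∑ i, α i * y i = 0 at hx
    have hP1 := (hq.parallel_form y).1
    have e1 : ∑ i, (if r {i} = r ∅ + 1 ∧ q {i} = R then ((m + 1)! : ℝ) else 0) * y i = 0 := by
      refine Finset.sum_eq_zero fun i _ => ?_
      have := hq.pair_facts i i
      rw [if_neg (by omega), zero_mul]
    -- Pairs raising `q` by two are automatically `r`-independent, so only `q`-parallelism matters.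
    have e2 : ∑ i, ∑ j, (if r {i, j} = r ∅ + 2 ∧ q {i, j} = R then (m ! : ℝ) else 0) *
        y i * y j = m ! * ((∑ i, α i * y i) * (∑ i, α i * y i) -
          ∑ i, ∑ j, (if q {i} = q ∅ + 1 ∧ q {j} = q ∅ + 1 ∧ q {i, j} = q ∅ + 1
            then (1 : ℝ) else 0) * y i * y j) := by
      rw [← sum_mul_sum_form α α]
      simp only [← Finset.sum_sub_distrib, Finset.mul_sum]
      refine Finset.sum_congr rfl fun i _ => Finset.sum_congr rfl fun j _ => ?_
      have hf := hr.pair_facts i j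
      have hg := hq.pair_facts i j
      have hij := h.quot ∅ {i, j} (by simp)
      rw [← sub_mul, ← sub_mul, ← mul_assoc, ← mul_assoc]
      congr 2
      simp only [α]
      split_ifs <;> first | omega | simp
    change 2 * x none * ∑ i, _ * y i + ∑ i, ∑ j, _ * y i * y j ≤ 0
    rw [e1, e2, hx]
    have := mul_nonneg hm.le hP1
    linarith
  · refine reversed_cauchy_of_hyperplane _ hs a (fun _ => 0) hnn fun x _ => ?_
    rw [hform, if_neg (by omega), Finset.sum_eq_zero, Finset.sum_eq_zero]
    · simp
    · intro i _
      refine Finset.sum_eq_zero fun j _ => ?_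
      have hg := hq.pair_facts i j
      rw [if_neg (by omega), zero_mul, zero_mul]
    · intro i _
      have hg := hq.pair_facts i i
      rw [if_neg (by omega), zero_mul]

end Quadratic

/-! ### Connectedness of the Hessian, and the induction on the degree. -/

section Connected

variable {E : Type*} [DecidableEq E]

theorem isQuotientBasis_contract_erase {r q : Finset E → ℕ} {R : ℕ} (hr : IsRank r)
    {S : Finset E} (hS : IsQuotientBasis r q R S) {i : E} (hi : i ∈ S) :
    IsQuotientBasis (contract i r) (contract i q) R (S.erase i) := by
  rw [isQuotientBasis_contract hr (hr.nonloop_of_indep hS.1 hi), Finset.insert_erase hi]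
  exact ⟨Finset.notMem_erase i S, hS⟩

variable [Fintype E]

theorem hessian_none_some_pos {r q : Finset E → ℕ} {R n d : ℕ} (hr : IsRank r)
    {a : Option E → ℝ} (ha : ∀ v, 0 < a v) {S : Finset E} (hS : IsQuotientBasis r q R S)
    (hd : S.card ≤ d + 1) {i : E} (hi : i ∈ S) :
    0 < eval a (pderiv none (pderiv (some i) (basisPoly r q R (n + 2) (d + 2)))) := by
  rw [pderiv_some_basisPoly hr R (n + 1) (d + 1) (hr.nonloop_of_indep hS.1 hi),
    pderiv_none_basisPoly]
  refine eval_basisPoly_pos ha (isQuotientBasis_contract_erase hr hS hi) ?_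
  rw [Finset.card_erase_of_mem hi]
  omega

theorem hessian_some_some_pos {r q : Finset E → ℕ} {R n d : ℕ} (hr : IsRank r)
    {a : Option E → ℝ} (ha : ∀ v, 0 < a v) {S : Finset E} (hS : IsQuotientBasis r q R S)
    (hd : S.card ≤ d + 2) {i j : E} (hi : i ∈ S) (hj : j ∈ S) (hij : i ≠ j) :
    0 < eval a (pderiv (some i) (pderiv (some j) (basisPoly r q R (n + 2) (d + 2)))) := by
  have h1 := isQuotientBasis_contract_erase hr hS hj
  have hi' : i ∈ S.erase j := Finset.mem_erase.2 ⟨hij, hi⟩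
  rw [pderiv_some_basisPoly hr R (n + 1) (d + 1) (hr.nonloop_of_indep hS.1 hj),
    pderiv_some_basisPoly (hr.contract j) R n d ((hr.contract j).nonloop_of_indep h1.1 hi')]
  refine eval_basisPoly_pos ha (isQuotientBasis_contract_erase (hr.contract j) h1 hi') ?_
  rw [Finset.card_erase_of_mem hi', Finset.card_erase_of_mem hj]
  omega

theorem exists_basis_of_pderiv_ne_zero {r q : Finset E → ℕ} {R n d : ℕ} (hr : IsRank r)
    {v : Option E} (h : pderiv v (basisPoly r q R (n + 1) (d + 1)) ≠ 0) :
    ∃ S, IsQuotientBasis r q R S ∧ S.card ≤ d + 1 ∧ (v = none → S.card ≤ d) ∧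
      ∀ i, v = some i → i ∈ S := by
  cases v with
  | none =>
    rw [pderiv_none_basisPoly] at h
    obtain ⟨S, hS, hd⟩ := (basisPoly_eq_zero_or_exists _ _ _ _ _).resolve_left h
    exact ⟨S, hS, by omega, fun _ => hd, fun i hi => by cases hi⟩
  | some i =>
    by_cases hi : r {i} = r ∅ + 1
    · rw [pderiv_some_basisPoly hr R n d hi] at h
      obtain ⟨S, hS, hd⟩ := (basisPoly_eq_zero_or_exists _ _ _ _ _).resolve_left h
      rw [isQuotientBasis_contract hr hi] at hS
      refine ⟨insert i S, hS.2, ?_, fun h => by (cases h), fun j hj => ?_⟩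
      · rw [Finset.card_insert_of_notMem hS.1]; omega
      · cases hj; exact Finset.mem_insert_self _ _
    · exact absurd (pderiv_some_basisPoly_of_loop hr R _ _ hi) h

/-- The Hessian of `basisPoly` is connected in degree at least three. -/
theorem connected_hessian_basisPoly {r q : Finset E → ℕ} {R n d : ℕ} (h : IsQuotientPair r q R)
    {a : Option E → ℝ} (ha : ∀ v, 0 < a v) (u : Option E → ℝ)
    (hu : ∀ v w, 0 < eval a (pderiv v (pderiv w (basisPoly r q R (n + 3) (d + 3)))) → u v = u w)
    (v w v' w' : Option E)
    (hv : 0 < eval a (pderiv v (pderiv v' (basisPoly r q R (n + 3) (d + 3)))))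
    (hw : 0 < eval a (pderiv w (pderiv w' (basisPoly r q R (n + 3) (d + 3))))) :
    u v = u w := by
  have hr := h.rank
  have hq := h.rank_quot
  have hactive : ∀ v v', 0 < eval a (pderiv v (pderiv v' (basisPoly r q R (n + 3) (d + 3)))) →
      ∃ S, IsQuotientBasis r q R S ∧ S.card ≤ d + 3 ∧ (v = none → S.card ≤ d + 2) ∧
        ∀ i, v = some i → i ∈ S := by
    intro v v' hv
    refine exists_basis_of_pderiv_ne_zero (n := n + 2) hr fun h0 => ?_
    rw [pderiv_pderiv_comm, h0, map_zero, map_zero] at hv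
    exact lt_irrefl _ hv
  have hns : ∀ S, IsQuotientBasis r q R S → S.card ≤ d + 2 → ∀ i ∈ S, u (some i) = u none :=
    fun S hS hd i hi => (hu _ _ (hessian_none_some_pos hr ha hS hd hi)).symm
  have hss : ∀ S, IsQuotientBasis r q R S → S.card ≤ d + 3 → ∀ i ∈ S, ∀ j ∈ S,
      u (some i) = u (some j) := by
    intro S hS hd i hi j hj
    by_cases hij : i = j
    · rw [hij]
    · exact hu _ _ (hessian_some_some_pos hr ha hS hd hi hj hij)
  have hindep : ∀ S, q S = q ∅ + S.card → r S = r ∅ + S.card := by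
    intro S hS
    have h1 := h.quot ∅ S (Finset.empty_subset S)
    have h2 := hr.le_card S
    omega
  have hR := h.le ∅
  have hcard : ∀ S, IsQuotientBasis r q R S → R ≤ q ∅ + S.card := by
    intro S hS
    have := hq.le_card S
    have := hS.2
    omega
  -- If the corank is below the degree, `none` is a hub: a basis containing `i` contains a
  -- `q`-independent basis `B` of size at most `d + 2`, whose elements are adjacent to `none`. When
  -- `B` is empty, `{i}` is itself a basis.
  by_cases hk : R < q ∅ + (d + 3)
  · have key : ∀ v v', 0 < eval a (pderiv v (pderiv v' (basisPoly r q R (n + 3) (d + 3)))) →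
        u v = u none := by
      intro v v' hv
      cases v with
      | none => rfl
      | some i =>
        obtain ⟨S, hS, hSd, -, hiS⟩ := hactive _ _ hv
        have hi := hiS i rfl
        obtain ⟨B, -, hBS, hBi, hBq⟩ := hq.exists_basis (Finset.empty_subset S) (by simp)
        have hB : IsQuotientBasis r q R B := ⟨hindep B hBi, hBq.trans hS.2⟩
        have hBc : B.card ≤ d + 2 := by have := hB.2; omega
        rcases B.eq_empty_or_nonempty with rfl | ⟨j, hj⟩
        · refine hns {i} ⟨by simpa using hr.nonloop_of_indep hS.1 hi, ?_⟩ (by simp) i (by simp)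
          exact le_antisymm (h.le _) (hB.2 ▸ hq.mono _ _ (Finset.empty_subset _))
        · rw [hss S hS hSd i hi j (hBS hj), hns B hB hBc j hj]
    rw [key v v' hv, key w w' hw]
  -- Now every basis of size at most `d + 3` has exactly that size and is `q`-independent, so the
  -- row of `none` is zero. Extending `{j}` inside `insert j S` gives a basis through `j` that meets
  -- `S`, linking `j` to `i`.
  · obtain ⟨S, hS, hSd, hSn, hiS⟩ := hactive _ _ hv
    obtain ⟨T, hT, hTd, hTn, hjT⟩ := hactive _ _ hw
    have hSc := hcard S hS
    have hTc := hcard T hT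
    cases v with
    | none => have := hSn rfl; omega
    | some i =>
      cases w with
      | none => have := hTn rfl; omega
      | some j =>
        have hi := hiS i rfl
        have hj := hjT j rfl
        have hTi : q T = q ∅ + T.card := by have := hT.2; omega
        have hjq : q {j} = q ∅ + ({j} : Finset E).card := by
          simpa using hq.nonloop_of_indep hTi hj
        obtain ⟨B, hjB, hBS, hBi, hBq⟩ := hq.exists_basis
          (Finset.singleton_subset_iff.2 (Finset.mem_insert_self j S)) hjq
        have hBR : q B = R := by
          refine le_antisymm (h.le B) ?_
          rw [hBq, ← hS.2]
          exact hq.mono _ _ (Finset.subset_insert _ _)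
        have hB : IsQuotientBasis r q R B := ⟨hindep B hBi, hBR⟩
        have hj' : j ∈ B := hjB (Finset.mem_singleton_self j)
        obtain ⟨l, hl, hlj⟩ := Finset.exists_mem_ne (s := B) (by omega) j
        have hlS : l ∈ S := (Finset.mem_insert.1 (hBS hl)).resolve_left hlj
        rw [hss S hS hSd i hi l hlS, hss B hB (by omega) l hl j hj']

theorem IsBasisPoly.reversedCauchy {d : ℕ} {p : MvPolynomial (Option E) ℝ}
    (hp : IsBasisPoly (d + 2) p) : ReversedCauchy p := by
  induction d generalizing p with
  | zero =>
    rcases hp with rfl | ⟨r, q, R, n, h, hc, hd, rfl⟩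
    · intro a _ x; simp
    · obtain ⟨m, rfl⟩ : ∃ m, n = m + 2 := ⟨n - 2, by omega⟩
      exact reversedCauchy_basisPoly_two h hc
  | succ d ih =>
    refine reversedCauchy_of_pderiv hp.isHomogeneous
      (fun a ha v w => ((hp.pderiv w).pderiv v).eval_nonneg ha)
      (fun a ha v w z => (((hp.pderiv z).pderiv w).pderiv v).eval_nonneg ha) ?_
      fun v => ih (hp.pderiv v)
    intro a ha u hu v w v' w' hv hw
    rcases hp with rfl | ⟨r, q, R, n, h, hc, hd, rfl⟩
    · simp at hv
    · obtain ⟨m, rfl⟩ : ∃ m, n = m + 3 := ⟨n - 3, by omega⟩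
      exact connected_hessian_basisPoly h ha u hu v w v' w' hv hw

end Connected

/-! ### Setting the homogenizing variable to one. -/

section Dehomogenization

open Nat

variable {E : Type*}

/-- The substitution of `1` for the homogenizing variable. -/
noncomputable def dehomogenize : MvPolynomial (Option E) ℝ →ₐ[ℝ] MvPolynomial E ℝ :=
  aeval fun v => v.elim 1 X

theorem eval_dehomogenize (w : E → ℝ) (p : MvPolynomial (Option E) ℝ) :
    eval w (dehomogenize p) = eval (fun v => v.elim 1 w) p := by
  induction p using MvPolynomial.induction_on with
  | C c => simp [dehomogenize]
  | add p q hp hq => simp [hp, hq]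
  | mul_X p v hp =>
    rw [map_mul, map_mul, map_mul, hp]
    cases v <;> simp [dehomogenize]

theorem pderiv_dehomogenize (i : E) (p : MvPolynomial (Option E) ℝ) :
    pderiv i (dehomogenize p) = dehomogenize (pderiv (some i) p) := by
  classical
  induction p using MvPolynomial.induction_on with
  | C c => simp [dehomogenize]
  | add p q hp hq => simp [hp, hq]
  | mul_X p v hp =>
    rw [map_mul, pderiv_mul, pderiv_mul, map_add, map_mul, map_mul, hp]
    cases v with
    | none => simp [dehomogenize, pderiv_X]
    | some j =>
      by_cases hij : i = j
      · subst hij; simp [dehomogenize]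
      · simp [dehomogenize, pderiv_X, Ne.symm hij]

variable [Fintype E] [DecidableEq E]

/-- Setting `w₀ = 1` restricts to an affine slice of the larger positive orthant, and concavity
survives restriction to it. -/
theorem IsBasisPoly.dehomogenize_eq_zero_or_isLogConcave {d : ℕ}
    {p : MvPolynomial (Option E) ℝ} (hp : IsBasisPoly d p) :
    dehomogenize p = 0 ∨ IsLogConcave (dehomogenize p) := by
  rcases hp.eq_zero_or_pos with rfl | hpos
  · exact Or.inl (map_zero _)
  right
  have hlift : ∀ w : E → ℝ, (∀ i, 0 < w i) → ∀ v : Option E, 0 < v.elim 1 w := by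
    intro w hw v
    cases v
    · exact one_pos
    · exact hw _
  refine ⟨fun w hw => ?_, ?_⟩
  · rw [eval_dehomogenize]
    exact hpos _ (hlift w hw)
  have hconc := concaveOn_log_eval hpos fun a ha x =>
    eval_mul_hessian_le hp.isHomogeneous (fun hd => by
      obtain ⟨e, rfl⟩ : ∃ e, d = e + 2 := ⟨d - 2, by omega⟩
      exact hp.reversedCauchy) a ha x
  have helim : ∀ (w w' : E → ℝ) (s t : ℝ), s + t = 1 →
      (fun v : Option E => v.elim 1 (s • w + t • w')) =
        s • (fun v : Option E => v.elim 1 w) + t • (fun v : Option E => v.elim 1 w') := by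
    intro w w' s t hst
    ext v
    cases v <;> simp [hst]
  refine ⟨?_, ?_⟩
  · intro x hx y hy s t hs ht hst i
    have := hconc.1 (hlift x hx) (hlift y hy) hs ht hst (some i)
    simpa using this
  · intro x hx y hy s t hs ht hst
    have := hconc.2 (hlift x hx) (hlift y hy) hs ht hst
    simp only [eval_dehomogenize, helim x y s t hst]
    exact this

theorem foldr_pderiv_dehomogenize (l : List E) {d : ℕ} {p : MvPolynomial (Option E) ℝ}
    (hp : IsBasisPoly d p) : ∃ e g, IsBasisPoly e g ∧
      l.foldr (fun i g => pderiv i g) (dehomogenize p) = dehomogenize g := by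
  induction l with
  | nil => exact ⟨d, p, hp, rfl⟩
  | cons i l ih =>
    obtain ⟨e, g, hg, h⟩ := ih
    rw [List.foldr_cons, h, pderiv_dehomogenize]
    cases e with
    | zero =>
      have h0 := hg.isHomogeneous
      rw [← totalDegree_zero_iff_isHomogeneous, totalDegree_eq_zero_iff_eq_C] at h0
      refine ⟨0, 0, Or.inl rfl, ?_⟩
      rw [h0, pderiv_C]
    | succ e => exact ⟨e, _, hg.pderiv _, rfl⟩

end Dehomogenization

/-! ### From morphisms of matroids to quotient pairs. -/

section Matroid

variable {E F : Type*}

theorem coe_rk [Finite E] (M : Matroid E) (S : Set E) : (rk M S : ℕ∞) = M.eRk S :=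
  ENat.natCast_toNat (ne_top_of_le_ne_top (Set.encard_ne_top_iff.2 S.toFinite) (M.eRk_le_encard S))

theorem rk_mono [Finite E] (M : Matroid E) {S T : Set E} (h : S ⊆ T) : rk M S ≤ rk M T := by
  have := M.eRk_mono h
  rw [← coe_rk, ← coe_rk] at this
  exact_mod_cast this

theorem isRank_rk_image [DecidableEq E] [Finite F] (N : Matroid F) (f : E → F) :
    IsRank fun S : Finset E => rk N (f '' (S : Set E)) where
  mono S T h := rk_mono N (Set.image_mono (by exact_mod_cast h))
  submod S T := by
    have h1 := N.eRk_inter_add_eRk_union_le (f '' (S : Set E)) (f '' (T : Set E))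
    have h2 : rk N (f '' ((S ∩ T : Finset E) : Set E)) ≤
        rk N (f '' (S : Set E) ∩ f '' (T : Set E)) :=
      rk_mono N (by rw [Finset.coe_inter]; exact Set.image_inter_subset f _ _)
    simp only [← coe_rk] at h1
    rw [← Set.image_union, ← Finset.coe_union] at h1
    have h3 : rk N (f '' (S : Set E) ∩ f '' (T : Set E)) +
      rk N (f '' ((S ∪ T : Finset E) : Set E)) ≤
        rk N (f '' (S : Set E)) + rk N (f '' (T : Set E)) := by exact_mod_cast h1
    omega
  insert_le i S := by
    have := N.eRk_insert_le_add_one (f i) (f '' (S : Set E))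
    rw [← Set.image_insert_eq, ← Finset.coe_insert, ← coe_rk, ← coe_rk] at this
    exact_mod_cast this

theorem isRank_rk [DecidableEq E] [Finite E] (M : Matroid E) :
    IsRank fun S : Finset E => rk M (S : Set E) := by
  simpa using isRank_rk_image M (id : E → E)

theorem isQuotientPair_of_isMorphism [DecidableEq E] [Finite E] [Finite F] {M : Matroid E}
    {N : Matroid F} {f : E → F} (hf : IsMorphism M N f) :
    IsQuotientPair (fun S : Finset E => rk M (S : Set E))
      (fun S : Finset E => rk N (f '' (S : Set E))) (rk N Set.univ) where
  rank := isRank_rk M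
  rank_quot := isRank_rk_image N f
  quot S T h := by
    have := hf S T (by exact_mod_cast h)
    omega
  le S := rk_mono N (Set.subset_univ _)

theorem isBasisOf_iff [Finite E] [Finite F] (M : Matroid E) (N : Matroid F) (f : E → F)
    (hN : N.E = Set.univ) (S : Finset E) :
    IsBasisOf M N f S ↔ IsQuotientBasis (fun S : Finset E => rk M (S : Set E))
      (fun S : Finset E => rk N (f '' (S : Set E))) (rk N Set.univ) S := by
  have h1 : (∃ B, M.IsBase B ∧ (S : Set E) ⊆ B) ↔
      rk M (S : Set E) = rk M ((∅ : Finset E) : Set E) + S.card := by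
    have h0 : rk M ((∅ : Finset E) : Set E) = 0 := by simp [rk]
    rw [h0, zero_add, ← Matroid.indep_iff, Matroid.indep_iff_eRk_eq_encard_of_finite S.finite_toSet,
      ← coe_rk, Set.encard_coe_eq_coe_finsetCard]
    norm_cast
  have h2 : (∃ C, N.IsBase C ∧ C ⊆ f '' (S : Set E)) ↔
      rk N (f '' (S : Set E)) = rk N Set.univ := by
    constructor
    · rintro ⟨C, hC, hCS⟩
      refine le_antisymm (rk_mono N (Set.subset_univ _)) ?_
      refine le_trans (le_of_eq ?_) (rk_mono N hCS)
      rw [rk, rk, hC.eRk_eq_eRank, Matroid.eRk_univ_eq]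
    · intro h
      have : N.Spanning (f '' (S : Set E)) := by
        rw [Matroid.spanning_iff_eRk_le (by rw [hN]; exact Set.subset_univ _), ← coe_rk, h,
          coe_rk, Matroid.eRk_univ_eq]
      exact this.exists_isBase_subset
  exact and_congr h1 h2

open Classical in
theorem basisGenPoly_eq_sum [Fintype E] (M : Matroid E) (N : Matroid F) (f : E → F) :
    basisGenPoly M N f =
      ∑ S : Finset E, if IsBasisOf M N f (S : Set E) then ∏ i ∈ S, X i else 0 := by
  unfold basisGenPoly
  symm
  rw [Finset.sum_filter]
  -- The index in the definition of `basisGenPoly` elaborates to a set, running over a supremum of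
  -- singletons of coerced finsets; the sum is reindexed along the coercion.
  refine Finset.sum_nbij (fun S => (S : Set E)) (fun S _ => ?_)
    Finset.coe_injective.injOn (fun T _ => ⟨T.toFinset, by simp, by simp⟩) (fun S _ => ?_)
  · exact Finset.mem_sup.2 ⟨S, Finset.mem_univ S, Finset.mem_singleton_self _⟩
  · rw [Finset.toFinset_coe]

theorem basisGenPoly_eq_dehomogenize [Fintype E] [Finite F] (M : Matroid E)
    (N : Matroid F) (f : E → F) (hN : N.E = Set.univ) :
    basisGenPoly M N f = dehomogenize (basisPoly (fun S : Finset E => rk M (S : Set E))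
      (fun S : Finset E => rk N (f '' (S : Set E))) (rk N Set.univ)
      (Fintype.card E) (Fintype.card E)) := by
  rw [basisGenPoly_eq_sum, basisPoly, map_sum, Finset.sum_filter]
  refine Finset.sum_congr rfl fun S _ => ?_
  simp only [isBasisOf_iff M N f hN, S.card_le_univ, and_true]
  split_ifs
  -- With `n = d` the two factorials cancel.
  · rw [div_self (by positivity)]
    simp [dehomogenize, map_mul, map_prod]
  · rfl

theorem coeff_basisGenPoly_nonneg [Fintype E] (M : Matroid E) (N : Matroid F) (f : E → F)
    (m : E →₀ ℕ) : 0 ≤ (basisGenPoly M N f).coeff m := by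
  classical
  rw [basisGenPoly_eq_sum, coeff_sum]
  refine Finset.sum_nonneg fun S _ => ?_
  have : (∏ i ∈ S, X i : MvPolynomial E ℝ) = monomial (∑ i ∈ S, Finsupp.single i 1) 1 := by
    rw [monomial_sum_one]; rfl
  rw [this]
  split_ifs
  · rw [coeff_monomial]
    split_ifs <;> norm_num
  · simp

end Matroid

end MatroidMorphism

open MatroidMorphism in
theorem theorem1 {E F : Type*} [Fintype E] [Finite F]
    (M : Matroid E) (hM : M.E = Set.univ) (N : Matroid F) (hN : N.E = Set.univ)
    (f : E → F) (hf : MatroidMorphism.IsMorphism M N f) :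
    (MatroidMorphism.basisGenPoly M N f = 0 ∨
      MatroidMorphism.IsLogConcave (MatroidMorphism.basisGenPoly M N f)) ∧
    MatroidMorphism.IsStronglyLogConcave (MatroidMorphism.basisGenPoly M N f) := by
  classical
  have hp : IsBasisPoly (Fintype.card E) (basisPoly (fun S : Finset E => rk M (S : Set E))
      (fun S : Finset E => rk N (f '' (S : Set E))) (rk N Set.univ)
      (Fintype.card E) (Fintype.card E)) :=
    Or.inr ⟨_, _, _, _, isQuotientPair_of_isMorphism hf, Finset.card_le_univ _, le_rfl, rfl⟩
  have hslc : ∀ l : List E,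
      l.foldr (fun i g => MvPolynomial.pderiv i g) (basisGenPoly M N f) = 0 ∨
        IsLogConcave (l.foldr (fun i g => MvPolynomial.pderiv i g) (basisGenPoly M N f)) := by
    intro l
    rw [basisGenPoly_eq_dehomogenize M N f hN]
    obtain ⟨e, g, hg, h⟩ := foldr_pderiv_dehomogenize l hp
    rw [h]
    exact hg.dehomogenize_eq_zero_or_isLogConcave
  exact ⟨hslc [], coeff_basisGenPoly_nonneg M N f, hslc⟩
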